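/- **Theorem 4.** Consider a finite set of nodes with a connected contact graph and a destination node $d$; $\mathcal S_i$ is the set of neighbours of $i$. Every pair of neighbours $i,j$ meets repeatedly: the time until its first meeting and the times between its consecutive meetings are exponentially distributed with rate $\lambda_{ij}>0$, and all these times, over all pairs, are independent. For a binary matrix $\mathbf B=(b_{ij})$ let $L_{id}(\mathbf B)\in[0,\infty]$ be the expected time until a message generated at node $i$ at time $0$ reaches $d$, if a node $h$ holding the message hands it over on meeting $j$ exactly when $b_{hj}=1$. Let $\mathbf B^*$ be a binary matrix minimizing $\sum_i L_{id}(\mathbf B)$ over all binary matrices. In MinLat-E every node $j$ keeps estimates $\widetilde L_{id}(j)$ of the latencies from all nodes $i$ to $d$ and its row of a binary decision matrix. Initially the decision matrix is zero, $\widetilde L_{dd}(j)=0$ and $\widetilde L_{id}(j)=\infty$ for $i\ne d$. The pair $i,j$ estimates $\lambda_{ij}$ after each of its meetings by the maximum-likelihood value $\widehat\lambda_{ij}=n/\sum_{m=1}^n x_m$, where $x_m$ is the time between its $m$-th and $(m+1)$-th meetings and $n$ is the number of such times observed so far (while $n=0$, $\widehat\lambda_{ij}$ is some fixed initial value in $[0,\infty)$).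 When $i$ and $j$ meet, they update $\widehat\lambda_{ij}$ and tell each other their own latency estimates, $\widetilde L_{id}(j):=\widetilde L_{id}(i)$ and $\widetilde L_{jd}(i):=\widetilde L_{jd}(j)$; then each $a\in\{i,j\}$ with $a\ne d$ sets $$\widetilde L_{ad}(a):=\min_{m\in\{0,1\}^{\mathcal S_a}}\frac{1+\sum_{k\in\mathcal S_a}m_k\widehat\lambda_{ak}\widetilde L_{kd}(a)}{\sum_{k\in\mathcal S_a}m_k\widehat\lambda_{ak}}$$ (with $1/0=\infty$ and $0\cdot\infty=0$) and takes a minimizing $m$ (any, if there are several) as row $a$ of the decision matrix. Let $\widetilde{\mathbf B}_t$ be the decision matrix and $\widetilde L_{id,t}(\widetilde{\mathbf B}_t,i)$ the estimate at node $i$ of its own latency at time $t$. Then for every node $i$, $L_{id}(\mathbf B^*)<\infty$ and, as $t\to\infty$, both the estimated latency $\widetilde L_{id,t}(\widetilde{\mathbf B}_t,i)$ and the achieved expected latency $L_{id}(\widetilde{\mathbf B}_t)$ converge in probability to $L_{id}(\mathbf B^*)$: for every $\epsilon>0$, $$\lim_{t\to\infty}P\big(|\widetilde L_{id,t}(\widetilde{\mathbf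 B}_t,i)-L_{id}(\mathbf B^*)|<\epsilon\big)=1,\qquad \lim_{t\to\infty}P\big(|L_{id}(\widetilde{\mathbf B}_t)-L_{id}(\mathbf B^*)|<\epsilon\big)=1 .$$ -/

import Mathlib

open MeasureTheory ProbabilityTheory Filter Topology
open scoped ENNReal NNReal

namespace MinLat

noncomputable section

/-- A network of mobile nodes: a connected contact graph (an edge joins two nodes that meet) and,
for each pair of neighbouring nodes, a positive meeting rate. -/
structure ContactNetwork (V : Type*) where
  graph : SimpleGraph V
  connected : graph.Connected
  rate : graph.edgeSet → ℝ
  rate_pos : ∀ e, 0 < rate e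

variable {V : Type*}

/-- The pairs of nodes that meet. -/
abbrev ContactNetwork.Pair (W : ContactNetwork V) : Type _ := W.graph.edgeSet

/-- A realization of the contacts. `x (e, 0)` is the time from the start until the first meeting of
the pair `e`, and `x (e, n)`, for `n ≥ 1`, is the time between its `n`-th and `(n+1)`-th meetings. -/
abbrev ContactNetwork.Path (W : ContactNetwork V) : Type _ := W.Pair × ℕ → ℝ

/-- A binary decision matrix `B`, given by its rows: `B i = {j | b_ij = 1}`. -/
abbrev DecisionMatrix (V : Type*) : Type _ := V → Finset V

namespace ContactNetwork

variable (W : ContactNetwork V)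

/-! ### The sequence of meetings -/

/-- The instant of the `(n+1)`-th meeting of the pair `e`. -/
def arrival (x : W.Path) (e : W.Pair) (n : ℕ) : ℝ := ∑ k ∈ Finset.range (n + 1), x (e, k)

open Classical in
/-- The pair that meets next when each pair `e` has already met `c e` times
(`none` only if no two nodes ever meet). -/
def nextPair (x : W.Path) (c : W.Pair → ℕ) : Option W.Pair :=
  if h : ∃ e, ∀ f, W.arrival x e (c e) ≤ W.arrival x f (c f) then some h.choose else none

open Classical in
/-- How often each pair has met during the first `k` meetings in the network. -/
def counts (x : W.Path) : ℕ → W.Pair → ℕ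
  | 0 => fun _ => 0
  | k + 1 => fun e =>
      if W.nextPair x (counts x k) = some e then counts x k e + 1 else counts x k e

/-- The pair that takes part in the meeting number `k` (counting from `0`) of the network. -/
def pairAt (x : W.Path) (k : ℕ) : Option W.Pair := W.nextPair x (W.counts x k)

/-- The instant at which the first `k` meetings of the network are over. -/
def timeAfter (x : W.Path) : ℕ → ℝ
  | 0 => 0
  | k + 1 =>
      match W.pairAt x k with
      | none => timeAfter x k
      | some e => W.arrival x e (W.counts x k e)

/-- The number of meetings in the network up to and including time `t`. -/
def meetingsUntil (x : W.Path) (t : ℝ) : ℕ := {k : ℕ | W.timeAfter x (k + 1) ≤ t}.ncard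

/-! ### Expected latency of a fixed decision matrix -/

open Classical in
/-- What happens at a meeting to a message held by node `h`: if `h` meets `j`,
it hands the message over exactly when `b_hj = 1`. -/
def handOver (B : DecisionMatrix V) (e : Option W.Pair) (h : V) : V :=
  match e with
  | none => h
  | some e =>
      if hm : h ∈ (e : Sym2 V) then
        if Sym2.Mem.other hm ∈ B h then Sym2.Mem.other hm else h
      else h

/-- The node holding, after `k` meetings in the network, a message generated by `i` at time `0`. -/
def holder (x : W.Path) (B : DecisionMatrix V) (i : V) : ℕ → V
  | 0 => i
  | k + 1 => W.handOver B (W.pairAt x k) (holder x B i k)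

/-- The latency of that message: the first instant at which `d` holds it, `∞` if there is none. -/
def latency (d : V) (x : W.Path) (B : DecisionMatrix V) (i : V) : ℝ≥0∞ :=
  ⨅ (k : ℕ) (_ : W.holder x B i k = d), ENNReal.ofReal (W.timeAfter x k)

/-- The distribution of each inter-meeting time of the pair `e`. -/
def gapLaw (e : W.Pair) : Measure ℝ := expMeasure (W.rate e)

instance (e : W.Pair) : IsProbabilityMeasure (W.gapLaw e) :=
  isProbabilityMeasure_expMeasure (W.rate_pos e)

/-- The law of the contacts: independent exponential inter-meeting times. -/
def contactLaw : Measure W.Path := Measure.infinitePi (fun p : W.Pair × ℕ => W.gapLaw p.1)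

/-- `L_id(B)`: the expected latency from `i` to `d` under the decision matrix `B`. -/
def expectedLatency (d : V) (B : DecisionMatrix V) (i : V) : ℝ≥0∞ :=
  ∫⁻ x, W.latency d x B i ∂W.contactLaw

/-- `B` minimizes the sum of the expected latencies of all nodes over all binary matrices. -/
def IsOptimal [Fintype V] (d : V) (B : DecisionMatrix V) : Prop :=
  ∀ B' : DecisionMatrix V,
    ∑ i, W.expectedLatency d B i ≤ ∑ i, W.expectedLatency d B' i

/-! ### The algorithm MinLat-E -/

/-- The maximum-likelihood estimate `n / (x_1 + ⋯ + x_n)` of the rate of an exponential law. -/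
def mle (y : ℕ → ℝ) (n : ℕ) : ℝ := n / ∑ k ∈ Finset.Icc 1 n, y k

/-- The recursive form in which a node updates the estimate. -/
theorem mle_succ (y : ℕ → ℝ) (n : ℕ) (hn : 1 ≤ n) (h : 0 < ∑ k ∈ Finset.Icc 1 n, y k)
    (hy : 0 ≤ y (n + 1)) :
    mle y (n + 1) = (n + 1 : ℝ) * mle y n / (n + mle y n * y (n + 1)) := by
  have hn' : (0 : ℝ) < n := by exact_mod_cast hn
  unfold mle
  rw [Finset.sum_Icc_succ_top (by omega)]
  set s := ∑ k ∈ Finset.Icc 1 n, y k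
  have h1 : s + y (n + 1) ≠ 0 := by positivity
  have h2 : (n : ℝ) + n / s * y (n + 1) = n * (s + y (n + 1)) / s := by field_simp
  rw [h2]
  push_cast
  field_simp

/-- The estimate of the meeting rate of the pair `e` once it has met `c` times, which gives `c - 1`
samples; as long as there is no sample it has some initial value `r₀ e`. -/
def pairEstimate (r₀ : W.Pair → ℝ≥0) (x : W.Path) (e : W.Pair) (c : ℕ) : ℝ≥0∞ :=
  if c ≤ 1 then (r₀ e : ℝ≥0∞) else ENNReal.ofReal (mle (fun k => x (e, k)) (c - 1))

open Classical in
/-- Node `i`'s estimate of its meeting rate with its neighbour `j`, after `k` meetings in the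
network. The value `0` for non-neighbours is never used. -/
def rateEstimate (r₀ : W.Pair → ℝ≥0) (x : W.Path) (k : ℕ) (i j : V) : ℝ≥0∞ :=
  if h : W.graph.Adj i j then
    W.pairEstimate r₀ x ⟨s(i, j), h⟩ (W.counts x k ⟨s(i, j), h⟩)
  else 0

/-- The objective `(1 + ∑ m_k l_k L_k) / ∑ m_k l_k` of the local optimization, where `m` is the
indicator of `S`. Here `1 / 0 = ∞`, and a neighbour of infinite latency outside `S` has no effect. -/
def objective (l L : V → ℝ≥0∞) (S : Finset V) : ℝ≥0∞ :=
  (1 + ∑ k ∈ S, l k * L k) / ∑ k ∈ S, l k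

/-- The minimum of the objective over all sets of neighbours of `i`. -/
def minObjective (i : V) (l L : V → ℝ≥0∞) : ℝ≥0∞ :=
  ⨅ (S : Finset V) (_ : ∀ k ∈ S, W.graph.Adj i k), objective l L S

/-- `S` is a set of neighbours of `i` that attains the minimum. -/
def IsMinimizer (i : V) (l L : V → ℝ≥0∞) (S : Finset V) : Prop :=
  (∀ k ∈ S, W.graph.Adj i k) ∧ objective l L S = W.minObjective i l L

open Classical in
/-- When the pair `e` meets, its two nodes tell each other their own latency estimates.
Here `L a b` is the estimate at node `a` of the latency from `b` to the destination. -/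
def exchange (e : W.Pair) (L : V → V → ℝ≥0∞) (a b : V) : ℝ≥0∞ :=
  if s(a, b) = (e : Sym2 V) then L b b else L a b

open Classical in
/-- The estimates after a meeting of the pair `e`: the two nodes exchange their own estimates, then
each of them, unless it is the destination, minimizes with its current rate estimates `l`. -/
def updateTable (d : V) (l : V → V → ℝ≥0∞) (e : W.Pair) (L : V → V → ℝ≥0∞) (a b : V) : ℝ≥0∞ :=
  if b = a ∧ a ∈ (e : Sym2 V) ∧ a ≠ d then W.minObjective a (l a) (W.exchange e L a)
  else W.exchange e L a b

open Classical in
/-- The latency estimates in MinLat-E after `k` meetings in the network: the entry `a b` is the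
estimate at node `a` of the latency from `b` to `d`. -/
def latencyTable (d : V) (r₀ : W.Pair → ℝ≥0) (x : W.Path) : ℕ → V → V → ℝ≥0∞
  | 0 => fun _ b => if b = d then 0 else ∞
  | k + 1 =>
      match W.pairAt x k with
      | none => latencyTable d r₀ x k
      | some e =>
          W.updateTable d (W.rateEstimate r₀ x (k + 1)) e (latencyTable d r₀ x k)

/-- Node `i` takes part in the meeting number `k`. -/
def Meets (x : W.Path) (k : ℕ) (i : V) : Prop := ∃ e, W.pairAt x k = some e ∧ i ∈ (e : Sym2 V)

/-- `D k` is the decision matrix of MinLat-E after `k` meetings in the network: it starts from the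
zero matrix, and at each of its meetings a node other than `d` sets its row to a minimizer of its
local optimization (any of them, if there are several). -/
def IsDecisionSequence (d : V) (r₀ : W.Pair → ℝ≥0) (x : W.Path)
    (D : ℕ → DecisionMatrix V) : Prop :=
  (∀ i, D 0 i = ∅) ∧
  ∀ k i,
    (W.Meets x k i ∧ i ≠ d →
      W.IsMinimizer i (W.rateEstimate r₀ x (k + 1) i) (W.latencyTable d r₀ x (k + 1) i)
        (D (k + 1) i)) ∧
    (¬ (W.Meets x k i ∧ i ≠ d) → D (k + 1) i = D k i)

/-- The estimate at node `i`, at time `t`, of its own expected latency to `d`. -/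
def estimatedLatency (d : V) (r₀ : W.Pair → ℝ≥0) (x : W.Path) (t : ℝ) (i : V) : ℝ≥0∞ :=
  W.latencyTable d r₀ x (W.meetingsUntil x t) i i

end ContactNetwork

/-- `Y t` converges in probability, as `t → ∞`, to the finite constant `c`: for each `ε > 0` the
probability that `|Y t - c| < ε` fails (in particular that `Y t = ∞`) tends to `0`. -/
def ConvergesInProbability {Ω : Type*} [MeasurableSpace Ω] (μ : Measure Ω)
    (Y : ℝ → Ω → ℝ≥0∞) (c : ℝ≥0∞) : Prop :=
  c ≠ ∞ ∧ ∀ ε : ℝ, 0 < ε →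
    Tendsto (fun t => μ {ω | ¬ (Y t ω ≠ ∞ ∧ |(Y t ω).toReal - c.toReal| < ε)}) atTop (𝓝 0)

end

end MinLat

/-! The key object is the optimality equation `v d = 0`, `v i = minObjective i (trueRate i) v` for
`i ≠ d`. It is shown that the estimates converge almost surely to a solution `v`, and that a
solution is necessarily the vector of optimal latencies.

Fixed matrix. By memorylessness, the contacts after a first meeting of `e` again have law
`contactLaw`, and `e` is first with probability `rate e / totalRate` (`map_shift_restrict_isFirst`).
Hence the latencies solve linear first-step equations and are their least solution in `[0,∞]`
(`expectedLatency_eq`, `expectedLatency_le`). After cancelling the meetings that move nothing, the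
equation at `i` reads `∑ λ_ij (L_i - L_j) = 1` over the neighbours `j` in row `i`: the objective at
that row equals `L_i`. So finite latencies form a supersolution of the optimality equation.

Comparison. A subsolution vanishing at `d` lies below every finite supersolution
(`le_of_le_minObjective`). Therefore `v` is a lower bound for the latencies of every matrix for
which they are all finite, and is attained by matrices whose rows are minimizers.

Algorithm. Almost surely the rate estimates converge (law of large numbers) and every pair meets
infinitely often, in finite numbers by any given time. As the objective is monotone in the latencies
and continuous at positive finite rates, the limsup of the nodes' own estimates is a subsolution and
the liminf a supersolution. Comparison makes them equal (`Regular.exists_limit`). Since there are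
only finitely many rows, minimizers for nearby data are minimizers for the limit, so the achieved
latency is eventually exactly `v`.

Probability. The increasing measurable events `settled` exhaust almost all realizations, so their
complements have measure tending to `0`; this bounds the failure probabilities for both quantities.
-/

namespace MinLat.ContactNetwork

noncomputable section

open scoped Classical

variable {V : Type*} (W : ContactNetwork V)

/-! ### Removing the first meeting -/

/-- The contacts after the first meeting, when that is a meeting of `e`. -/
def shift (e : W.Pair) (x : W.Path) : W.Path := fun p =>
  if p.1 = e then x (e, p.2 + 1) else if p.2 = 0 then x p - x (e, 0) else x p

theorem arrival_zero (x : W.Path) (e : W.Pair) : W.arrival x e 0 = x (e, 0) := by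
  simp [arrival]

theorem arrival_succ (x : W.Path) (e : W.Pair) (n : ℕ) :
    W.arrival x e (n + 1) = W.arrival x e n + x (e, n + 1) := by
  simp [arrival, Finset.sum_range_succ _ (n + 1)]

theorem arrival_shift (e : W.Pair) (x : W.Path) (f : W.Pair) (n : ℕ) :
    W.arrival (W.shift e x) f n = W.arrival x f (n + if f = e then 1 else 0) - x (e, 0) := by
  by_cases h : f = e
  · subst h
    simp only [if_true]
    induction n with
    | zero => simp [arrival_succ, arrival_zero, shift]
    | succ n ih => rw [arrival_succ, ih, arrival_succ _ _ _ (n + 1)]; simp [shift]; ring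
  · simp only [if_neg h, add_zero]
    induction n with
    | zero => simp [arrival_zero, shift, h]
    | succ n ih => rw [arrival_succ, ih, arrival_succ]; simp [shift, h]; ring

/-- All arrivals move by the same amount, so the set of earliest pairs is unchanged. The two choice
predicates are equal, hence ties are also broken alike. -/
theorem nextPair_shift (e : W.Pair) (x : W.Path) (c : W.Pair → ℕ) :
    W.nextPair (W.shift e x) c = W.nextPair x (fun f => c f + if f = e then 1 else 0) := by
  simp only [nextPair, arrival_shift, sub_le_sub_iff_right]

theorem counts_succ_apply (x : W.Path) (k : ℕ) (f : W.Pair) :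
    W.counts x (k + 1) f =
      if W.pairAt x k = some f then W.counts x k f + 1 else W.counts x k f := rfl

theorem counts_zero (x : W.Path) (f : W.Pair) : W.counts x 0 f = 0 := rfl

theorem counts_shift {e : W.Pair} {x : W.Path} (h : W.pairAt x 0 = some e) (k : ℕ) (f : W.Pair) :
    W.counts x (k + 1) f = W.counts (W.shift e x) k f + if f = e then 1 else 0 := by
  induction k generalizing f with
  | zero =>
    simp [counts_succ_apply, counts_zero, h, eq_comm]
  | succ k ih =>
    have hp : W.pairAt x (k + 1) = W.pairAt (W.shift e x) k := by
      rw [pairAt, pairAt, nextPair_shift, ← funext ih]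
    rw [counts_succ_apply, counts_succ_apply _ (W.shift e x), hp, ih]
    split_ifs <;> omega

theorem pairAt_shift {e : W.Pair} {x : W.Path} (h : W.pairAt x 0 = some e) (k : ℕ) :
    W.pairAt x (k + 1) = W.pairAt (W.shift e x) k := by
  rw [pairAt, pairAt, nextPair_shift, ← funext (W.counts_shift h k)]

theorem holder_shift {e : W.Pair} {x : W.Path} (h : W.pairAt x 0 = some e)
    (B : DecisionMatrix V) (i : V) (k : ℕ) :
    W.holder x B i (k + 1) = W.holder (W.shift e x) B (W.handOver B (some e) i) k := by
  induction k with
  | zero => simp [holder, h]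
  | succ k ih => rw [holder, ih, pairAt_shift W h, holder]

/-- The time between the first `k` meetings and the next one. -/
def gap (x : W.Path) (k : ℕ) : ℝ := W.timeAfter x (k + 1) - W.timeAfter x k

theorem timeAfter_succ {x : W.Path} {k : ℕ} {e : W.Pair} (h : W.pairAt x k = some e) :
    W.timeAfter x (k + 1) = W.arrival x e (W.counts x k e) := by
  rw [timeAfter, h]

theorem timeAfter_succ_none {x : W.Path} {k : ℕ} (h : W.pairAt x k = none) :
    W.timeAfter x (k + 1) = W.timeAfter x k := by
  rw [timeAfter, h]

theorem timeAfter_shift {e : W.Pair} {x : W.Path} (h : W.pairAt x 0 = some e) (k : ℕ) :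
    W.timeAfter x (k + 1) = x (e, 0) + W.timeAfter (W.shift e x) k := by
  induction k with
  | zero => rw [timeAfter_succ W h]; simp [timeAfter, counts, arrival_zero]
  | succ k ih =>
    rcases hp : W.pairAt x (k + 1) with _ | f
    · rw [timeAfter_succ_none W hp, timeAfter_succ_none W ((pairAt_shift W h k).symm.trans hp), ih]
    · rw [timeAfter_succ W hp, timeAfter_succ W ((pairAt_shift W h k).symm.trans hp),
        arrival_shift, ← counts_shift W h]
      ring

theorem gap_shift {e : W.Pair} {x : W.Path} (h : W.pairAt x 0 = some e) (k : ℕ) :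
    W.gap x (k + 1) = W.gap (W.shift e x) k := by
  rw [gap, gap, timeAfter_shift W h, timeAfter_shift W h]; ring

/-- The contribution of the `(k+1)`-th meeting to the latency: the time waited for it,
if the message has not reached `d` before. -/
def wait (d : V) (B : DecisionMatrix V) (k : ℕ) (i : V) (x : W.Path) : ℝ≥0∞ :=
  if ∀ j ≤ k, W.holder x B i j ≠ d then ENNReal.ofReal (W.gap x k) else 0

theorem wait_zero (d : V) (B : DecisionMatrix V) (i : V) (x : W.Path) :
    W.wait d B 0 i x = if i = d then 0 else ENNReal.ofReal (W.timeAfter x 1) := by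
  by_cases h : i = d <;> simp [wait, holder, gap, timeAfter, h]

/-- This recursion in `k` is what turns the law of the shifted contacts into the first-step
equations. -/
theorem wait_succ {e : W.Pair} {x : W.Path} (h : W.pairAt x 0 = some e)
    (d : V) (B : DecisionMatrix V) (k : ℕ) (i : V) :
    W.wait d B (k + 1) i x =
      if i = d then 0 else W.wait d B k (W.handOver B (some e) i) (W.shift e x) := by
  have key : (∀ j ≤ k + 1, W.holder x B i j ≠ d) ↔
      i ≠ d ∧ ∀ j ≤ k, W.holder (W.shift e x) B (W.handOver B (some e) i) j ≠ d := by
    constructor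
    · exact fun H => ⟨H 0 (by omega), fun j hj => holder_shift W h B i j ▸ H (j + 1) (by omega)⟩
    · rintro ⟨h0, H⟩ (_ | j) hj
      · exact h0
      · rw [holder_shift W h]; exact H j (by omega)
  by_cases hi : i = d
  · rw [wait, if_neg fun H => (key.1 H).1 hi, if_pos hi]
  · simp only [wait, key, gap_shift W h, hi, ne_eq, not_false_eq_true, true_and, if_false]

/-! ### Regular realizations -/

/-- Contacts with positive inter-meeting times that obey the law of large numbers. -/
structure Regular (x : W.Path) : Prop where
  pos : ∀ p, 0 < x p
  arrival_tendsto : ∀ e, Tendsto (W.arrival x e) atTop atTop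
  mle_tendsto : ∀ e, Tendsto (mle fun k => x (e, k)) atTop (𝓝 (W.rate e))

theorem arrival_le_of_nextPair {x : W.Path} {c : W.Pair → ℕ} {e : W.Pair}
    (h : W.nextPair x c = some e) (f : W.Pair) : W.arrival x e (c e) ≤ W.arrival x f (c f) := by
  unfold nextPair at h
  split_ifs at h with hh
  have := hh.choose_spec f
  rwa [Option.some.inj h] at this

theorem exists_nextPair [Finite W.Pair] [Nonempty W.Pair] (x : W.Path) (c : W.Pair → ℕ) :
    ∃ e, W.nextPair x c = some e := by
  have := Finite.exists_min (fun e => W.arrival x e (c e))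
  rw [nextPair, dif_pos this]
  exact ⟨_, rfl⟩

theorem exists_pairAt [Finite W.Pair] [Nonempty W.Pair] (x : W.Path) (k : ℕ) :
    ∃ e, W.pairAt x k = some e := W.exists_nextPair x _

theorem counts_succ {x : W.Path} {k : ℕ} {e : W.Pair} (h : W.pairAt x k = some e) (f : W.Pair) :
    W.counts x (k + 1) f = W.counts x k f + if f = e then 1 else 0 := by
  rw [counts_succ_apply, h]
  by_cases hf : f = e
  · simp [hf]
  · simp [hf, Ne.symm hf]

theorem counts_mono (x : W.Path) (e : W.Pair) : Monotone fun k => W.counts x k e :=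
  monotone_nat_of_le_succ fun k => by rw [counts_succ_apply]; split_ifs <;> omega

variable {W}

theorem Regular.arrival_mono {x : W.Path} (hx : W.Regular x) (e : W.Pair) :
    Monotone (W.arrival x e) :=
  monotone_nat_of_le_succ fun n => by
    rw [arrival_succ]; linarith [hx.pos (e, n + 1)]

section

variable [Finite W.Pair] [Nonempty W.Pair] {x : W.Path}

theorem Regular.timeAfter_le_arrival (hx : W.Regular x) (k : ℕ) (f : W.Pair) :
    W.timeAfter x k ≤ W.arrival x f (W.counts x k f) := by
  cases k with
  | zero => simpa [timeAfter, counts, arrival_zero] using (hx.pos (f, 0)).le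
  | succ k =>
    obtain ⟨e, he⟩ := W.exists_pairAt x k
    rw [timeAfter_succ W he]
    exact (arrival_le_of_nextPair W he f).trans
      (hx.arrival_mono f (W.counts_mono x f (Nat.le_succ k)))

theorem Regular.timeAfter_mono (hx : W.Regular x) : Monotone (W.timeAfter x) :=
  monotone_nat_of_le_succ fun k => by
    obtain ⟨e, he⟩ := W.exists_pairAt x k
    rw [timeAfter_succ W he]
    exact hx.timeAfter_le_arrival k e

theorem sum_counts [Fintype W.Pair] (x : W.Path) (k : ℕ) : ∑ e, W.counts x k e = k := by
  induction k with
  | zero => simp [counts]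
  | succ k ih =>
    obtain ⟨e, he⟩ := W.exists_pairAt x k
    simp [counts_succ W he, Finset.sum_add_distrib, ih]

/-- If `e` stayed at count at most `c`, no other pair could meet after the pending arrival of `e`.
All counts would then be bounded, but they sum to the number of meetings. -/
theorem Regular.counts_tendsto (hx : W.Regular x) (e : W.Pair) :
    Tendsto (fun k => W.counts x k e) atTop atTop := by
  have : Fintype W.Pair := Fintype.ofFinite _
  refine tendsto_atTop_atTop_of_monotone (W.counts_mono x e) ?_
  by_contra! hcon
  obtain ⟨c, hc⟩ := hcon
  have hN : ∀ f, ∃ N, W.arrival x e c < W.arrival x f N := fun f =>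
    ((hx.arrival_tendsto f).eventually_gt_atTop _).exists
  choose N hN using hN
  have hb : ∀ k f, W.counts x k f ≤ N f := by
    intro k
    induction k with
    | zero => simp [counts]
    | succ k ih =>
      intro f
      obtain ⟨g, hg⟩ := W.exists_pairAt x k
      rw [counts_succ W hg]
      split_ifs with hfg
      · subst hfg
        have h1 := arrival_le_of_nextPair W hg e
        have h2 := hx.arrival_mono e (hc k).le
        by_contra! hlt
        have h3 := hx.arrival_mono f (show N f ≤ W.counts x k f by omega)
        linarith [hN f]
      · exact ih f
  have h1 := sum_counts x (∑ f, N f + 1)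
  have h2 := Finset.sum_le_sum fun f (_ : f ∈ Finset.univ) => hb (∑ f, N f + 1) f
  omega

theorem Regular.timeAfter_tendsto (hx : W.Regular x) : Tendsto (W.timeAfter x) atTop atTop := by
  rw [← tendsto_add_atTop_iff_nat 1, tendsto_atTop]
  intro M
  have : ∀ᶠ k in atTop, ∀ e, M ≤ W.arrival x e (W.counts x k e) :=
    eventually_all.2 fun e =>
      ((hx.arrival_tendsto e).comp (hx.counts_tendsto e)).eventually_ge_atTop M
  filter_upwards [this] with k hk
  obtain ⟨e, he⟩ := W.exists_pairAt x k
  rw [timeAfter_succ W he]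
  exact hk e

theorem Regular.le_meetingsUntil (hx : W.Regular x) {t : ℝ} {n : ℕ}
    (h : ∀ k < n, W.timeAfter x (k + 1) ≤ t) : n ≤ W.meetingsUntil x t := by
  -- `Set.ncard` is `0` on infinite sets, so finiteness is needed for any lower bound.
  have hfin : {k : ℕ | W.timeAfter x (k + 1) ≤ t}.Finite := by
    have := ((tendsto_add_atTop_iff_nat 1).2 hx.timeAfter_tendsto).eventually_gt_atTop t
    obtain ⟨N, hN⟩ := eventually_atTop.1 this
    refine (Set.finite_lt_nat N).subset fun k hk => ?_
    by_contra hlt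
    exact absurd hk (not_le.2 (hN k (not_lt.1 hlt)))
  have := Set.ncard_le_ncard (s := (Finset.range n : Set ℕ))
    (fun k hk => h k (by simpa using hk)) hfin
  rw [Set.ncard_coe_finset, Finset.card_range] at this
  exact this

theorem Regular.meets_infinitely (hx : W.Regular x) (e : W.Pair) (K : ℕ) :
    ∃ k ≥ K, W.pairAt x k = some e := by
  by_contra! h
  have hc : ∀ k ≥ K, W.counts x k e = W.counts x K e := by
    intro k hk
    induction k, hk using Nat.le_induction with
    | base => rfl
    | succ k hk ih =>
      obtain ⟨f, hf⟩ := W.exists_pairAt x k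
      have : e ≠ f := fun he => h k hk (he ▸ hf)
      rw [counts_succ W hf, if_neg this, ih, add_zero]
  obtain ⟨k, hk, hk'⟩ :=
    ((hx.counts_tendsto e).eventually_gt_atTop (W.counts x K e)).and (eventually_ge_atTop K) |>.exists
  exact absurd (hc k hk') hk.ne'

theorem Regular.gap_nonneg (hx : W.Regular x) (k : ℕ) : 0 ≤ W.gap x k :=
  sub_nonneg.2 (hx.timeAfter_mono (Nat.le_succ k))

theorem Regular.sum_gap (hx : W.Regular x) (n : ℕ) :
    ∑ k ∈ Finset.range n, ENNReal.ofReal (W.gap x k) = ENNReal.ofReal (W.timeAfter x n) := by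
  rw [← ENNReal.ofReal_sum_of_nonneg fun k _ => hx.gap_nonneg k]
  unfold gap
  rw [Finset.sum_range_sub]
  simp [timeAfter]

/-- The gaps telescope up to the first visit to `d`. Without a visit both sides are `∞`, because the
meeting times are unbounded. -/
theorem Regular.latency_eq_tsum (hx : W.Regular x) (d : V) (B : DecisionMatrix V) (i : V) :
    W.latency d x B i = ∑' k, W.wait d B k i x := by
  by_cases h : ∃ k, W.holder x B i k = d
  · have h1 := Nat.find_spec h
    have h2 : ∀ k, W.wait d B k i x =
        if k < Nat.find h then ENNReal.ofReal (W.gap x k) else 0 := by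
      intro k
      rw [wait]
      congr 1
      simp only [ne_eq, Nat.lt_find_iff]
    rw [tsum_congr h2, tsum_eq_sum (s := Finset.range (Nat.find h))
      (fun k hk => if_neg (by simpa using hk)),
      Finset.sum_congr rfl (fun k hk => if_pos (Finset.mem_range.1 hk)), hx.sum_gap]
    refine le_antisymm (iInf₂_le (Nat.find h) h1) (le_iInf₂ fun k hk => ?_)
    exact ENNReal.ofReal_le_ofReal (hx.timeAfter_mono (Nat.find_min' h hk))
  · push Not at h
    have h2 : ∀ k, W.wait d B k i x = ENNReal.ofReal (W.gap x k) := fun k => by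
      rw [wait, if_pos fun j _ => h j]
    have h3 : ∑' k, W.wait d B k i x = ∞ := by
      rw [tsum_congr h2]
      refine tendsto_nhds_unique (ENNReal.tendsto_nat_tsum _) ?_
      simp only [hx.sum_gap]
      exact ENNReal.tendsto_ofReal_atTop.comp hx.timeAfter_tendsto
    rw [h3, latency]
    simp [h]

end

end

end MinLat.ContactNetwork

namespace MinLat

/-- Counts, meeting pairs and holders take countably many values, so one may fix their value and
treat the rest as a function of `x` alone. -/
theorem measurableSet_of_fibers {α ι : Type*} [MeasurableSpace α] [Countable ι] {g : α → ι}
    (hg : ∀ c, MeasurableSet {x | g x = c}) {p : ι → α → Prop}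
    (hp : ∀ c, MeasurableSet {x | p c x}) : MeasurableSet {x | p (g x) x} := by
  have : {x | p (g x) x} = ⋃ c, {x | g x = c} ∩ {x | p c x} := by
    ext x; simp
  rw [this]
  exact MeasurableSet.iUnion fun c => (hg c).inter (hp c)

theorem measurable_of_fibers {α β ι : Type*} [MeasurableSpace α] [MeasurableSpace β] [Countable ι]
    {g : α → ι} (hg : ∀ c, MeasurableSet {x | g x = c}) {F : ι → α → β}
    (hF : ∀ c, Measurable (F c)) : Measurable fun x => F (g x) x :=
  fun _ hs => measurableSet_of_fibers hg fun c => hF c hs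

namespace ContactNetwork

noncomputable section

open scoped Classical

variable {V : Type*} (W : ContactNetwork V)

/-! ### Measurability -/

@[fun_prop]
theorem measurable_arrival (e : W.Pair) (n : ℕ) : Measurable fun x => W.arrival x e n := by
  unfold arrival; fun_prop

@[fun_prop]
theorem measurable_shift (e : W.Pair) : Measurable (W.shift e) := by
  refine measurable_pi_lambda _ fun p => ?_
  unfold shift
  split_ifs <;> fun_prop

@[fun_prop]
theorem measurable_objective {α : Type*} [MeasurableSpace α] {l L : α → V → ℝ≥0∞}
    (hl : ∀ v, Measurable fun x => l x v) (hL : ∀ v, Measurable fun x => L x v) (S : Finset V) :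
    Measurable fun x => objective (l x) (L x) S := by
  unfold objective
  fun_prop

theorem measurable_minObjective [Finite V] {α : Type*} [MeasurableSpace α] {l L : α → V → ℝ≥0∞}
    (hl : ∀ v, Measurable fun x => l x v) (hL : ∀ v, Measurable fun x => L x v) (i : V) :
    Measurable fun x => W.minObjective i (l x) (L x) := by
  unfold minObjective
  exact Measurable.iInf fun S => Measurable.iInf fun _ => measurable_objective hl hL S

variable [Finite W.Pair]

theorem measurableSet_nextPair (c : W.Pair → ℕ) (o : Option W.Pair) :
    MeasurableSet {x | W.nextPair x c = o} := by
  have key : ∀ e, MeasurableSet {x | ∀ f, W.arrival x e (c e) ≤ W.arrival x f (c f)} := by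
    intro e
    simp only [Set.ofPred_forall]
    exact MeasurableSet.iInter fun f => measurableSet_le (by fun_prop) (by fun_prop)
  -- `nextPair` depends on `x` only through the set of earliest pairs, which has finitely many
  -- possible values; the arbitrary choice inside it is then harmless.
  refine measurableSet_of_fibers (ι := Set W.Pair)
    (g := fun x => {e | ∀ f, W.arrival x e (c e) ≤ W.arrival x f (c f)})
    (p := fun A _ => (if h : ∃ e, e ∈ A then some h.choose else none) = o) ?_
    fun A => MeasurableSet.const _
  intro A
  have : {x | {e | ∀ f, W.arrival x e (c e) ≤ W.arrival x f (c f)} = A} =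
      ⋂ e, {x | (∀ f, W.arrival x e (c e) ≤ W.arrival x f (c f)) ↔ e ∈ A} := by
    ext x
    rw [Set.mem_iInter]
    exact Set.ext_iff
  rw [this]
  exact MeasurableSet.iInter fun e => (key e).iff (MeasurableSet.const _)

theorem measurableSet_counts (k : ℕ) (c : W.Pair → ℕ) :
    MeasurableSet {x | W.counts x k = c} := by
  induction k generalizing c with
  | zero => exact MeasurableSet.const ((fun _ => 0) = c)
  | succ k ih =>
    refine measurableSet_of_fibers ih
      (p := fun c' x => (fun e => if W.nextPair x c' = some e then c' e + 1 else c' e) = c)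
      fun c' => ?_
    exact measurableSet_of_fibers (W.measurableSet_nextPair c')
      (p := fun o _ => (fun e => if o = some e then c' e + 1 else c' e) = c)
      fun o => MeasurableSet.const _

theorem measurableSet_pairAt (k : ℕ) (o : Option W.Pair) :
    MeasurableSet {x | W.pairAt x k = o} :=
  measurableSet_of_fibers (W.measurableSet_counts k) (p := fun c x => W.nextPair x c = o)
    fun c => W.measurableSet_nextPair c o

@[fun_prop]
theorem measurable_timeAfter (k : ℕ) : Measurable fun x => W.timeAfter x k := by
  induction k with
  | zero => exact measurable_const
  | succ k ih =>
    refine measurable_of_fibers (W.measurableSet_pairAt k) (F := fun o x =>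
      match o with
      | none => W.timeAfter x k
      | some e => W.arrival x e (W.counts x k e)) fun o => ?_
    cases o with
    | none => exact ih
    | some e =>
      exact measurable_of_fibers (W.measurableSet_counts k)
        (F := fun c x => W.arrival x e (c e)) fun c => by fun_prop

theorem measurableSet_holder [Finite V] (B : DecisionMatrix V) (i : V) (k : ℕ) (v : V) :
    MeasurableSet {x | W.holder x B i k = v} := by
  induction k generalizing v with
  | zero => exact MeasurableSet.const (i = v)
  | succ k ih =>
    refine measurableSet_of_fibers ih (p := fun h x => W.handOver B (W.pairAt x k) h = v)
      fun h => ?_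
    exact measurableSet_of_fibers (W.measurableSet_pairAt k)
      (p := fun o _ => W.handOver B o h = v) fun o => MeasurableSet.const _

@[fun_prop]
theorem measurable_wait [Finite V] (d : V) (B : DecisionMatrix V) (k : ℕ) (i : V) :
    Measurable (W.wait d B k i) := by
  refine Measurable.ite ?_ ?_ measurable_const
  · simp only [Set.ofPred_forall]
    exact MeasurableSet.iInter fun j => MeasurableSet.iInter fun _ =>
      (W.measurableSet_holder B i j d).compl
  · unfold gap; fun_prop

@[fun_prop]
theorem measurable_rateEstimate (r₀ : W.Pair → ℝ≥0) (k : ℕ) (i j : V) :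
    Measurable fun x => W.rateEstimate r₀ x k i j := by
  unfold rateEstimate
  split_ifs with h
  · refine measurable_of_fibers (W.measurableSet_counts k)
      (F := fun c x => W.pairEstimate r₀ x ⟨s(i, j), h⟩ (c ⟨s(i, j), h⟩)) fun c => ?_
    unfold pairEstimate mle
    split_ifs <;> fun_prop
  · exact measurable_const

theorem measurable_latencyTable [Finite V] (d : V) (r₀ : W.Pair → ℝ≥0) (k : ℕ) (a b : V) :
    Measurable fun x => W.latencyTable d r₀ x k a b := by
  induction k generalizing a b with
  | zero => exact measurable_const
  | succ k ih =>
    refine measurable_of_fibers (W.measurableSet_pairAt k) (F := fun o x =>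
      (match o with
        | none => W.latencyTable d r₀ x k
        | some e => W.updateTable d (W.rateEstimate r₀ x (k + 1)) e
            (W.latencyTable d r₀ x k)) a b) fun o => ?_
    cases o with
    | none => exact ih a b
    | some e =>
      have hex : ∀ a b, Measurable fun x => W.exchange e (W.latencyTable d r₀ x k) a b := by
        intro a b
        unfold exchange
        split_ifs
        · exact ih b b
        · exact ih a b
      simp only [updateTable]
      split_ifs
      · exact W.measurable_minObjective (W.measurable_rateEstimate r₀ (k + 1) a) (hex a) a
      · exact hex a b

theorem measurableSet_isMinimizer [Finite V] (d : V) (r₀ : W.Pair → ℝ≥0) (k : ℕ) (a : V)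
    (S : Finset V) :
    MeasurableSet {x | W.IsMinimizer a (W.rateEstimate r₀ x k a) (W.latencyTable d r₀ x k a) S} := by
  have hS : MeasurableSet {_x : W.Path | ∀ k ∈ S, W.graph.Adj a k} := MeasurableSet.const _
  refine hS.inter (measurableSet_eq_fun ?_ ?_)
  · exact measurable_objective (W.measurable_rateEstimate r₀ k a)
      (W.measurable_latencyTable d r₀ k a) S
  · exact W.measurable_minObjective (W.measurable_rateEstimate r₀ k a)
      (W.measurable_latencyTable d r₀ k a) a

theorem measurableSet_meets [Finite V] (k : ℕ) (a : V) : MeasurableSet {x | W.Meets x k a} :=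
  measurableSet_of_fibers (W.measurableSet_pairAt k)
    (p := fun o _ => ∃ e : W.Pair, o = some e ∧ a ∈ (e : Sym2 V)) fun _ => MeasurableSet.const _

end

end ContactNetwork

end MinLat

namespace MinLat

open Real (exp)

/-! ### The exponential distribution -/

theorem lintegral_exp_neg_mul {s : ℝ} (hs : 0 < s) :
    ∫⁻ t in Set.Ici (0 : ℝ), ENNReal.ofReal (exp (-(s * t))) = ENNReal.ofReal (1 / s) := by
  have h1 := lintegral_exponentialPDF_eq_one hs
  have h2 : ∀ t, exponentialPDF s t =
      ENNReal.ofReal s * (Set.Ici (0 : ℝ)).indicator (fun t => ENNReal.ofReal (exp (-(s * t)))) t := by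
    intro t
    rw [exponentialPDF_eq]
    by_cases h : 0 ≤ t
    · rw [if_pos h, Set.indicator_of_mem (Set.mem_Ici.2 h), ENNReal.ofReal_mul hs.le]
    · rw [if_neg h, Set.indicator_of_notMem (by simpa using h)]; simp
  simp_rw [h2] at h1
  rw [lintegral_const_mul _ (by measurability), lintegral_indicator measurableSet_Ici] at h1
  rw [one_div, ENNReal.ofReal_inv_of_pos hs]
  exact ENNReal.eq_inv_of_mul_eq_one_left (by rw [mul_comm]; exact h1)

theorem expMeasure_eq_withDensity (r : ℝ) :
    expMeasure r = volume.withDensity (exponentialPDF r) := rfl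

theorem measurable_exponentialPDF (r : ℝ) : Measurable (exponentialPDF r) :=
  (measurable_exponentialPDFReal r).ennreal_ofReal

theorem expMeasure_ae_pos (r : ℝ) : ∀ᵐ x ∂expMeasure r, 0 < x := by
  have : {x : ℝ | ¬ 0 < x} = Set.Iic 0 := by ext; simp
  rw [ae_iff, this, expMeasure_eq_withDensity, withDensity_apply _ measurableSet_Iic,
    ← setLIntegral_congr Iio_ae_eq_Iic, lintegral_exponentialPDF_of_nonpos le_rfl]

/-- With `c` the total rate of the competing pairs, this is the probability that a clock of rate `r`
rings first. -/
theorem lintegral_exp_expMeasure {r c : ℝ} (hr : 0 < r) (hc : 0 ≤ c) :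
    ∫⁻ u, ENNReal.ofReal (exp (-(c * u))) ∂expMeasure r = ENNReal.ofReal (r / (r + c)) := by
  rw [expMeasure_eq_withDensity, lintegral_withDensity_eq_lintegral_mul _
    (measurable_exponentialPDF r) (by fun_prop)]
  have h2 : ∀ t, (exponentialPDF r * fun u => ENNReal.ofReal (exp (-(c * u)))) t =
      ENNReal.ofReal r *
        (Set.Ici (0 : ℝ)).indicator (fun t => ENNReal.ofReal (exp (-((r + c) * t)))) t := by
    intro t
    rw [Pi.mul_apply, exponentialPDF_eq]
    by_cases h : 0 ≤ t
    · rw [if_pos h, Set.indicator_of_mem (Set.mem_Ici.2 h), ENNReal.ofReal_mul hr.le, mul_assoc,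
        ← ENNReal.ofReal_mul (Real.exp_pos _).le, ← Real.exp_add]
      ring_nf
    · rw [if_neg h, Set.indicator_of_notMem (by simpa using h)]; simp
  simp_rw [h2]
  rw [lintegral_const_mul _ (by measurability), lintegral_indicator measurableSet_Ici,
    lintegral_exp_neg_mul (by positivity), ← ENNReal.ofReal_mul hr.le, mul_one_div]

/-- The exponential distribution has no memory. -/
theorem expMeasure_sub_mem {r u : ℝ} (hu : 0 ≤ u) {A : Set ℝ} (hA : MeasurableSet A) :
    expMeasure r {y | u ≤ y ∧ y - u ∈ A} = ENNReal.ofReal (exp (-(r * u))) * expMeasure r A := by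
  have hS : MeasurableSet {y | u ≤ y ∧ y - u ∈ A} :=
    measurableSet_Ici.inter ((measurable_id.sub_const u) hA)
  rw [expMeasure_eq_withDensity, withDensity_apply _ hS, withDensity_apply _ hA,
    ← lintegral_indicator hS, ← lintegral_indicator hA,
    ← lintegral_add_right_eq_self _ u,
    ← lintegral_const_mul _ ((measurable_exponentialPDF r).indicator hA)]
  refine lintegral_congr fun z => ?_
  by_cases hz : 0 ≤ z
  · by_cases hzA : z ∈ A
    · rw [Set.indicator_of_mem (by simp [hz, hzA]), Set.indicator_of_mem hzA,
        exponentialPDF_of_nonneg hz, exponentialPDF_of_nonneg (by positivity),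
        ← ENNReal.ofReal_mul (Real.exp_pos _).le]
      congr 1
      rw [show -(r * (z + u)) = -(r * z) + -(r * u) by ring, Real.exp_add]
      ring
    · rw [Set.indicator_of_notMem (by simp [hzA]), Set.indicator_of_notMem hzA, mul_zero]
  · rw [Set.indicator_of_notMem (by simp [hz])]
    by_cases hzA : z ∈ A
    · rw [Set.indicator_of_mem hzA, exponentialPDF_of_neg (not_le.1 hz), mul_zero]
    · rw [Set.indicator_of_notMem hzA, mul_zero]

theorem expMeasure_Ici {r u : ℝ} (hr : 0 < r) (hu : 0 ≤ u) :
    expMeasure r (Set.Ici u) = ENNReal.ofReal (exp (-(r * u))) := by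
  have := isProbabilityMeasure_expMeasure hr
  have h := expMeasure_sub_mem (r := r) hu MeasurableSet.univ
  simpa [Set.Ici] using h

theorem lintegral_ofReal_expMeasure {r : ℝ} (hr : 0 < r) :
    ∫⁻ x, ENNReal.ofReal x ∂expMeasure r = ENNReal.ofReal (1 / r) := by
  rw [lintegral_eq_lintegral_meas_le _ ((expMeasure_ae_pos r).mono fun _ h => h.le)
    aemeasurable_id, ← lintegral_exp_neg_mul hr, ← setLIntegral_congr Ioi_ae_eq_Ici]
  exact setLIntegral_congr_fun measurableSet_Ioi fun t ht => expMeasure_Ici hr (le_of_lt ht)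

theorem integrable_id_expMeasure {r : ℝ} (hr : 0 < r) : Integrable id (expMeasure r) := by
  refine ⟨aestronglyMeasurable_id, ?_⟩
  rw [hasFiniteIntegral_iff_ofReal (f := id) ((expMeasure_ae_pos r).mono fun _ h => h.le)]
  simp only [id, lintegral_ofReal_expMeasure hr]
  exact ENNReal.ofReal_lt_top

theorem integral_id_expMeasure {r : ℝ} (hr : 0 < r) : ∫ x, x ∂expMeasure r = 1 / r := by
  rw [integral_eq_lintegral_of_nonneg_ae ((expMeasure_ae_pos r).mono fun _ h => h.le)
    aestronglyMeasurable_id, lintegral_ofReal_expMeasure hr, ENNReal.toReal_ofReal (by positivity)]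

end MinLat

namespace MinLat.ContactNetwork

noncomputable section

open scoped Classical
open Real (exp)

variable {V : Type*} (W : ContactNetwork V)

/-! ### The law of the contacts after the first meeting -/

instance : IsProbabilityMeasure W.contactLaw := by unfold contactLaw; infer_instance

/-- The contacts with first meeting time `u` of the pair `e`, all other times being given by `y`. -/
def prepend (e : W.Pair) (q : ℝ × W.Path) : W.Path := fun p =>
  if p.1 = e then if p.2 = 0 then q.1 else q.2 (e, p.2 - 1) else q.2 p

/-- The position in `prepend` of the given times. -/
def prependIndex (e : W.Pair) (p : W.Pair × ℕ) : W.Pair × ℕ :=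
  if p.1 = e then (e, p.2 + 1) else p

@[fun_prop]
theorem measurable_prepend (e : W.Pair) : Measurable (W.prepend e) := by
  refine measurable_pi_lambda _ fun p => ?_
  unfold prepend
  split_ifs <;> fun_prop

theorem prepend_first (e : W.Pair) (q : ℝ × W.Path) : W.prepend e q (e, 0) = q.1 := by
  simp [prepend]

theorem prepend_index (e : W.Pair) (q : ℝ × W.Path) (p : W.Pair × ℕ) :
    W.prepend e q (W.prependIndex e p) = q.2 p := by
  obtain ⟨f, n⟩ := p
  by_cases h : f = e
  · subst h; simp [prepend, prependIndex]
  · simp [prepend, prependIndex, h]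

theorem prependIndex_injective (e : W.Pair) : Function.Injective (W.prependIndex e) := by
  rintro ⟨f, n⟩ ⟨g, m⟩ h
  unfold prependIndex at h
  split_ifs at h with h1 h2 h2 <;> simp_all

theorem mem_range_prependIndex (e : W.Pair) (p : W.Pair × ℕ) :
    p ∈ Set.range (W.prependIndex e) ↔ p ≠ (e, 0) := by
  obtain ⟨f, n⟩ := p
  constructor
  · rintro ⟨⟨g, m⟩, h⟩ h0
    rw [h0] at h
    unfold prependIndex at h
    split_ifs at h with h1 <;> simp_all
  · intro h
    by_cases hf : f = e
    · subst hf
      cases n with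
      | zero => exact absurd rfl h
      | succ n => exact ⟨(f, n), by simp [prependIndex]⟩
    · exact ⟨(f, n), by simp [prependIndex, hf]⟩

theorem prependIndex_fst (e : W.Pair) (p : W.Pair × ℕ) : (W.prependIndex e p).1 = p.1 := by
  unfold prependIndex
  split_ifs with h
  · exact h.symm
  · rfl

/-- `prependIndex` is a bijection onto the indices other than `(e, 0)` that preserves the pair,
hence the marginal law. So preimages of boxes are boxes with the same factors, and boxes determine
the product measure. -/
theorem map_prepend (e : W.Pair) :
    ((W.gapLaw e).prod W.contactLaw).map (W.prepend e) = W.contactLaw := by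
  refine Measure.eq_infinitePi _ fun s t ht => ?_
  have hinj := W.prependIndex_injective e
  set s' := s.preimage (W.prependIndex e) hinj.injOn
  have hpre : W.prepend e ⁻¹' (Set.pi s t) =
      {u | (e, 0) ∈ s → u ∈ t (e, 0)} ×ˢ Set.pi s' fun p => t (W.prependIndex e p) := by
    ext ⟨u, y⟩
    simp only [Set.mem_preimage, Set.mem_pi, Set.mem_prod, Finset.mem_coe]
    constructor
    · intro h
      refine ⟨fun h0 => by simpa [prepend_first] using h _ h0, fun p hp => ?_⟩
      have := h _ (Finset.mem_preimage.1 hp)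
      rwa [prepend_index] at this
    · rintro ⟨h0, h⟩ p hp
      by_cases hpe : p = (e, 0)
      · subst hpe; simpa [prepend_first] using h0 hp
      · obtain ⟨q, rfl⟩ := (W.mem_range_prependIndex e p).2 hpe
        rw [prepend_index]
        exact h q (Finset.mem_preimage.2 hp)
  rw [Measure.map_apply (W.measurable_prepend e)
    (MeasurableSet.pi s.countable_toSet fun p _ => ht p), hpre, Measure.prod_prod, contactLaw,
    Measure.infinitePi_pi _ fun p _ => ht _]
  have h1 : ∏ p ∈ s', W.gapLaw p.1 (t (W.prependIndex e p)) =
      ∏ p ∈ s with p ≠ (e, 0), W.gapLaw p.1 (t p) := by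
    have := Finset.prod_preimage' (W.prependIndex e) s hinj.injOn fun p => W.gapLaw p.1 (t p)
    simp only [prependIndex_fst] at this
    rw [this]
    exact Finset.prod_congr (Finset.filter_congr fun p _ => W.mem_range_prependIndex e p)
      fun _ _ => rfl
  rw [h1, Finset.filter_ne']
  by_cases h0 : (e, 0) ∈ s
  · rw [← Finset.mul_prod_erase s _ h0]
    simp [h0]
  · simp [h0]

theorem shift_prepend (e : W.Pair) (q : ℝ × W.Path) (p : W.Pair × ℕ) :
    W.shift e (W.prepend e q) p = q.2 p - if p.1 ≠ e ∧ p.2 = 0 then q.1 else 0 := by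
  obtain ⟨f, n⟩ := p
  by_cases h : f = e
  · subst h; simp [shift, prepend]
  · by_cases hn : n = 0 <;> simp [shift, prepend, h, hn]

theorem pairwise_disjoint_pairAt :
    Pairwise (Function.onFun Disjoint fun e => {x | W.pairAt x 0 = some e}) := by
  intro e f hef
  refine Set.disjoint_left.2 fun x hx hy => hef ?_
  exact Option.some.inj (Eq.trans (Eq.symm hx) hy)

variable [Fintype W.Pair]

/-- The rate of all meetings together. -/
def totalRate : ℝ := ∑ e, W.rate e

theorem totalRate_pos [Nonempty W.Pair] : 0 < W.totalRate :=
  Finset.sum_pos (fun e _ => W.rate_pos e) Finset.univ_nonempty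

/-- No pair meets before `e`. -/
def isFirst (e : W.Pair) : Set W.Path := {x | ∀ f, x (e, 0) ≤ x (f, 0)}

theorem measurableSet_isFirst (e : W.Pair) : MeasurableSet (W.isFirst e) := by
  simp only [isFirst, Set.ofPred_forall]
  exact MeasurableSet.iInter fun f => measurableSet_le (by fun_prop) (by fun_prop)

/-- Here `u` is the first meeting time of `e`. The event is still a box: each other pair
contributes, through memorylessness of its first time, a factor `exp (-λ_f u)` and is otherwise
unaffected. -/
theorem contactLaw_section (e : W.Pair) {u : ℝ} (hu : 0 ≤ u) (s : Finset (W.Pair × ℕ))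
    {t : W.Pair × ℕ → Set ℝ} (ht : ∀ p, MeasurableSet (t p)) :
    W.contactLaw {y | (∀ f ≠ e, u ≤ y (f, 0)) ∧
        ∀ p ∈ s, y p - (if p.1 ≠ e ∧ p.2 = 0 then u else 0) ∈ t p} =
      ENNReal.ofReal (exp (-((W.totalRate - W.rate e) * u))) *
        ∏ p ∈ s, W.gapLaw p.1 (t p) := by
  set s₀ : Finset (W.Pair × ℕ) := (Finset.univ.erase e).image fun f => (f, 0)
  have hs₀ : ∀ p, p ∈ s₀ ↔ p.1 ≠ e ∧ p.2 = 0 := by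
    rintro ⟨f, n⟩
    simp only [s₀, Finset.mem_image, Finset.mem_erase, Finset.mem_univ, and_true, Prod.mk.injEq]
    constructor
    · rintro ⟨a, h1, h2, h3⟩; exact ⟨h2 ▸ h1, h3.symm⟩
    · rintro ⟨h1, h2⟩; exact ⟨f, h1, rfl, h2.symm⟩
  let t' : W.Pair × ℕ → Set ℝ := fun p => if p ∈ s then t p else Set.univ
  have ht' : ∀ p, MeasurableSet (t' p) := fun p => by
    simp only [t']; split_ifs; exacts [ht p, MeasurableSet.univ]
  -- The coordinates in `s₀` must exceed `u` even when they lie outside `s`; this is why `t'` is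
  -- extended by `univ`.
  let A : W.Pair × ℕ → Set ℝ := fun p => if p ∈ s₀ then {y | u ≤ y ∧ y - u ∈ t' p} else t' p
  have hA : ∀ p, MeasurableSet (A p) := fun p => by
    simp only [A]
    split_ifs
    · exact measurableSet_Ici.inter ((measurable_id.sub_const u) (ht' p))
    · exact ht' p
  have hset : {y : W.Path | (∀ f ≠ e, u ≤ y (f, 0)) ∧
      ∀ p ∈ s, y p - (if p.1 ≠ e ∧ p.2 = 0 then u else 0) ∈ t p} =
      Set.pi (s ∪ s₀ : Finset _) A := by
    ext y
    simp only [Set.mem_pi, Finset.mem_coe, Finset.mem_union]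
    constructor
    · rintro ⟨h1, h2⟩ p hp
      by_cases hp0 : p ∈ s₀
      · have hp0' := (hs₀ p).1 hp0
        simp only [A, if_pos hp0]
        refine ⟨?_, ?_⟩
        · obtain ⟨f, n⟩ := p
          obtain ⟨h3, rfl⟩ := hp0'
          exact h1 f h3
        · by_cases hps : p ∈ s
          · simpa [t', hps, hp0'] using h2 p hps
          · simp [t', hps]
      · have hps := hp.resolve_right hp0
        have := h2 p hps
        rw [if_neg (fun h => hp0 ((hs₀ p).2 h)), sub_zero] at this
        simpa [A, hp0, t', hps] using this
    · intro h
      refine ⟨fun f hf => ?_, fun p hp => ?_⟩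
      · have h0 : (f, 0) ∈ s₀ := (hs₀ _).2 ⟨hf, rfl⟩
        have := h (f, 0) (Or.inr h0)
        simp only [A, if_pos h0] at this
        exact this.1
      · have := h p (Or.inl hp)
        by_cases hp0 : p ∈ s₀
        · simp only [A, if_pos hp0, t', if_pos hp] at this
          rw [if_pos ((hs₀ p).1 hp0)]
          exact this.2
        · simp only [A, if_neg hp0, t', if_pos hp] at this
          rwa [if_neg (fun h => hp0 ((hs₀ p).2 h)), sub_zero]
  rw [hset, contactLaw, Measure.infinitePi_pi _ fun p _ => hA p]
  have h1 : ∀ p, W.gapLaw p.1 (A p) =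
      (if p ∈ s₀ then ENNReal.ofReal (exp (-(W.rate p.1 * u))) else 1) * W.gapLaw p.1 (t' p) := by
    intro p
    by_cases hp0 : p ∈ s₀
    · simp only [A, if_pos hp0]
      exact expMeasure_sub_mem hu (ht' p)
    · simp [A, hp0]
  have h2 : ∏ p ∈ s ∪ s₀, W.gapLaw p.1 (t' p) = ∏ p ∈ s, W.gapLaw p.1 (t p) := by
    rw [← Finset.prod_subset Finset.subset_union_left (fun p _ hp => by simp [t', hp])]
    exact Finset.prod_congr rfl fun p hp => by simp [t', hp]
  have h3 : ∏ p ∈ s ∪ s₀, (if p ∈ s₀ then ENNReal.ofReal (exp (-(W.rate p.1 * u))) else 1) =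
      ENNReal.ofReal (exp (-((W.totalRate - W.rate e) * u))) := by
    rw [Finset.prod_ite_mem, Finset.inter_eq_right.2 Finset.subset_union_right,
      Finset.prod_image (fun a _ b _ h => (Prod.mk.inj h).1),
      ← ENNReal.ofReal_prod_of_nonneg fun _ _ => (Real.exp_pos _).le, ← Real.exp_sum,
      Finset.sum_neg_distrib, ← Finset.sum_mul, Finset.sum_erase_eq_sub (Finset.mem_univ e)]
    rfl
  rw [Finset.prod_congr rfl fun p _ => h1 p, Finset.prod_mul_distrib, h2, h3]

theorem rate_div_add (e : W.Pair) :
    W.rate e / (W.rate e + (W.totalRate - W.rate e)) = W.rate e / W.totalRate := by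
  rw [add_sub_cancel]

theorem rate_le_totalRate (e : W.Pair) : W.rate e ≤ W.totalRate :=
  Finset.single_le_sum (fun f _ => (W.rate_pos f).le) (Finset.mem_univ e)

/-- Fubini over the first meeting time `u` of `e`: `contactLaw_section` evaluates each slice, and
the exponential factor integrates to the probability that `e` is first. -/
theorem contactLaw_isFirst_inter (e : W.Pair) (s : Finset (W.Pair × ℕ))
    {t : W.Pair × ℕ → Set ℝ} (ht : ∀ p, MeasurableSet (t p)) :
    W.contactLaw (W.isFirst e ∩ W.shift e ⁻¹' (Set.pi s t)) =
      ENNReal.ofReal (W.rate e / W.totalRate) * ∏ p ∈ s, W.gapLaw p.1 (t p) := by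
  have hm : MeasurableSet (W.isFirst e ∩ W.shift e ⁻¹' (Set.pi s t)) :=
    (W.measurableSet_isFirst e).inter
      (W.measurable_shift e (MeasurableSet.pi s.countable_toSet fun p _ => ht p))
  conv_lhs => rw [← W.map_prepend e]
  rw [Measure.map_apply (W.measurable_prepend e) hm,
    Measure.prod_apply (W.measurable_prepend e hm), ← W.rate_div_add e,
    ← lintegral_exp_expMeasure (W.rate_pos e) (sub_nonneg.2 (W.rate_le_totalRate e)),
    ← lintegral_mul_const _ (by fun_prop)]
  refine lintegral_congr_ae ?_
  filter_upwards [expMeasure_ae_pos (W.rate e)] with u hu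
  rw [← W.contactLaw_section e hu.le s ht]
  congr 1
  ext y
  simp only [Set.mem_preimage, Set.mem_inter_iff, Set.mem_pi, Finset.mem_coe, shift_prepend,
    isFirst, Set.mem_ofPred_eq, prepend_first]
  refine and_congr_left fun _ => forall_congr' fun f => ?_
  by_cases hf : f = e
  · subst hf; simp [prepend]
  · simp [prepend, hf]

/-- The Markov property at the first meeting. Dividing by the mass gives a measure with the values
of `contactLaw` on boxes, hence `contactLaw` itself. -/
theorem map_shift_restrict_isFirst [Nonempty W.Pair] (e : W.Pair) :
    (W.contactLaw.restrict (W.isFirst e)).map (W.shift e) =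
      ENNReal.ofReal (W.rate e / W.totalRate) • W.contactLaw := by
  have hc : ENNReal.ofReal (W.rate e / W.totalRate) ≠ 0 := by
    simpa using div_pos (W.rate_pos e) W.totalRate_pos
  have h : (ENNReal.ofReal (W.rate e / W.totalRate))⁻¹ •
      (W.contactLaw.restrict (W.isFirst e)).map (W.shift e) = W.contactLaw := by
    refine Measure.eq_infinitePi _ fun s t ht => ?_
    have hs : MeasurableSet (Set.pi (s : Set (W.Pair × ℕ)) t) :=
      MeasurableSet.pi s.countable_toSet fun p _ => ht p
    rw [Measure.smul_apply, Measure.map_apply (W.measurable_shift e) hs,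
      Measure.restrict_apply (W.measurable_shift e hs), Set.inter_comm,
      W.contactLaw_isFirst_inter e s ht, smul_eq_mul, ← mul_assoc,
      ENNReal.inv_mul_cancel hc ENNReal.ofReal_ne_top, one_mul]
  conv_rhs => rw [← h]
  rw [smul_smul, ENNReal.mul_inv_cancel hc ENNReal.ofReal_ne_top, one_smul]

theorem sum_rate_div [Nonempty W.Pair] :
    ∑ e, ENNReal.ofReal (W.rate e / W.totalRate) = 1 := by
  rw [← ENNReal.ofReal_sum_of_nonneg fun e _ => (div_pos (W.rate_pos e) W.totalRate_pos).le,
    ← Finset.sum_div]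
  change ENNReal.ofReal (W.totalRate / W.totalRate) = 1
  rw [div_self W.totalRate_pos.ne', ENNReal.ofReal_one]

theorem iUnion_pairAt [Nonempty W.Pair] : ⋃ e, {x | W.pairAt x 0 = some e} = Set.univ := by
  ext x
  simpa using W.exists_pairAt x 0

/-- Ties are null by counting mass: the events `pairAt x 0 = some e` partition the space, each lies
in `isFirst e`, and the masses of the latter also sum to `1`. -/
theorem pairAt_zero_ae_eq [Nonempty W.Pair] (e : W.Pair) :
    ({x | W.pairAt x 0 = some e} : Set W.Path) =ᵐ[W.contactLaw] W.isFirst e := by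
  have hsub : ∀ e, {x | W.pairAt x 0 = some e} ⊆ W.isFirst e := fun e x hx f => by
    simpa [counts_zero, arrival_zero] using arrival_le_of_nextPair W hx f
  have hm : ∀ e, W.contactLaw (W.isFirst e) = ENNReal.ofReal (W.rate e / W.totalRate) := by
    intro e
    simpa using W.contactLaw_isFirst_inter e ∅ (t := fun _ => Set.univ) fun _ => MeasurableSet.univ
  have hle : ∀ e, W.contactLaw {x | W.pairAt x 0 = some e} ≤ W.contactLaw (W.isFirst e) :=
    fun e => measure_mono (hsub e)
  have hsum : ∑ e, W.contactLaw {x | W.pairAt x 0 = some e} =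
      ∑ e, W.contactLaw (W.isFirst e) := by
    rw [Finset.sum_congr rfl fun e _ => hm e, W.sum_rate_div, ← tsum_fintype (L := .unconditional _),
      ← measure_iUnion W.pairwise_disjoint_pairAt fun e => W.measurableSet_pairAt 0 _,
      W.iUnion_pairAt, measure_univ]
  have heq : W.contactLaw (W.isFirst e) ≤ W.contactLaw {x | W.pairAt x 0 = some e} := by
    rw [← Finset.add_sum_erase _ _ (Finset.mem_univ e),
      ← Finset.add_sum_erase _ (fun e => W.contactLaw (W.isFirst e)) (Finset.mem_univ e)] at hsum
    have hfin : ∑ f ∈ Finset.univ.erase e, W.contactLaw {x | W.pairAt x 0 = some f} ≠ ∞ :=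
      ENNReal.sum_ne_top.2 fun f _ => measure_ne_top _ _
    rw [← ENNReal.add_le_add_iff_right hfin, hsum]
    exact add_le_add le_rfl (Finset.sum_le_sum fun f _ => hle f)
  exact ae_eq_of_subset_of_measure_ge (hsub e) heq (W.measurableSet_pairAt 0 _).nullMeasurableSet
    (measure_ne_top _ _)

theorem setLIntegral_shift [Nonempty W.Pair] (e : W.Pair) {h : W.Path → ℝ≥0∞} (hh : Measurable h) :
    ∫⁻ x in {x | W.pairAt x 0 = some e}, h (W.shift e x) ∂W.contactLaw =
      ENNReal.ofReal (W.rate e / W.totalRate) * ∫⁻ x, h x ∂W.contactLaw := by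
  rw [setLIntegral_congr (W.pairAt_zero_ae_eq e), ← lintegral_map hh (W.measurable_shift e),
    W.map_shift_restrict_isFirst e, lintegral_smul_measure, smul_eq_mul]

theorem lintegral_eq_sum_pairAt [Nonempty W.Pair] (F : W.Path → ℝ≥0∞) :
    ∫⁻ x, F x ∂W.contactLaw =
      ∑ e, ∫⁻ x in {x | W.pairAt x 0 = some e}, F x ∂W.contactLaw := by
  rw [← setLIntegral_univ, ← W.iUnion_pairAt,
    lintegral_iUnion (fun e => W.measurableSet_pairAt 0 _) W.pairwise_disjoint_pairAt,
    tsum_fintype]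

/-- The first meeting time is a minimum of independent exponentials, with tail `exp (-totalRate *
t)`; the tail is integrated. -/
theorem lintegral_timeAfter_one [Nonempty W.Pair] :
    ∫⁻ x, ENNReal.ofReal (W.timeAfter x 1) ∂W.contactLaw = ENNReal.ofReal (1 / W.totalRate) := by
  have hpi : ∀ t, {x | t ≤ W.timeAfter x 1} =
      Set.pi (Finset.univ.image fun f : W.Pair => (f, 0) : Finset (W.Pair × ℕ))
        fun _ => Set.Ici t := by
    intro t
    ext x
    obtain ⟨e, he⟩ := W.exists_pairAt x 0
    have h1 : W.timeAfter x 1 = x (e, 0) := by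
      rw [timeAfter_succ W he, counts_zero, arrival_zero]
    have h2 : ∀ f, x (e, 0) ≤ x (f, 0) := fun f => by
      simpa [counts_zero, arrival_zero] using arrival_le_of_nextPair W he f
    simp only [Set.mem_ofPred_eq, h1, Set.mem_pi, Finset.coe_image, Finset.coe_univ,
      Set.image_univ, Set.forall_mem_range, Set.mem_Ici]
    exact ⟨fun h f => h.trans (h2 f), fun h => h e⟩
  have hP : ∀ t, 0 ≤ t → W.contactLaw {x | t ≤ W.timeAfter x 1} =
      ENNReal.ofReal (exp (-(W.totalRate * t))) := by
    intro t ht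
    rw [hpi, contactLaw, Measure.infinitePi_pi _ fun _ _ => measurableSet_Ici,
      Finset.prod_image (fun a _ b _ h => (Prod.mk.inj h).1)]
    refine (Finset.prod_congr rfl fun e _ => expMeasure_Ici (W.rate_pos e) ht).trans ?_
    rw [← ENNReal.ofReal_prod_of_nonneg fun _ _ => (Real.exp_pos _).le, ← Real.exp_sum,
      Finset.sum_neg_distrib, ← Finset.sum_mul]
    rfl
  have h0 : 0 ≤ᵐ[W.contactLaw] fun x => W.timeAfter x 1 := by
    have := hP 0 le_rfl
    rw [mul_zero, neg_zero, Real.exp_zero, ENNReal.ofReal_one] at this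
    exact (prob_compl_eq_zero_iff (measurableSet_le measurable_const (by fun_prop))).2 this
  rw [lintegral_eq_lintegral_meas_le _ h0 (by fun_prop), ← lintegral_exp_neg_mul W.totalRate_pos,
    ← setLIntegral_congr Ioi_ae_eq_Ici]
  exact setLIntegral_congr_fun measurableSet_Ioi fun t ht => hP t (le_of_lt ht)

end

end MinLat.ContactNetwork

namespace MinLat.ContactNetwork

noncomputable section

open scoped Classical

variable {V : Type*} (W : ContactNetwork V)

/-! ### Almost all realizations are regular -/

theorem measurable_eval (p : W.Pair × ℕ) : Measurable fun x : W.Path => x p :=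
  measurable_pi_apply p

theorem map_eval_contactLaw (p : W.Pair × ℕ) :
    W.contactLaw.map (fun x => x p) = W.gapLaw p.1 :=
  Measure.infinitePi_map_eval _ p

theorem iIndepFun_eval : iIndepFun (fun p (x : W.Path) => x p) W.contactLaw :=
  iIndepFun_infinitePi (P := fun p : W.Pair × ℕ => W.gapLaw p.1) (X := fun _ x => x)
    fun _ => measurable_id

/-- The strong law for the gaps of index at least `1`, the ones that `mle` uses; the initial wait `x
(e, 0)` is left out. -/
theorem ae_tendsto_average (e : W.Pair) :
    ∀ᵐ x ∂W.contactLaw,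
      Tendsto (fun n : ℕ => (∑ k ∈ Finset.range n, x (e, k + 1) : ℝ) / (n : ℝ)) atTop
        (𝓝 (1 / W.rate e)) := by
  have hlaw : ∀ n, W.contactLaw.map (fun x => x (e, n + 1)) = expMeasure (W.rate e) :=
    fun n => W.map_eval_contactLaw _
  have h := strong_law_ae_real (μ := W.contactLaw) (fun n x => x (e, n + 1)) ?_ ?_ ?_
  · have hint : ∫ x, x (e, 0 + 1) ∂W.contactLaw = 1 / W.rate e := by
      rw [← integral_id_expMeasure (W.rate_pos e), ← hlaw 0,
        integral_map (W.measurable_eval _).aemeasurable (by fun_prop)]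
    rwa [hint] at h
  · have := integrable_id_expMeasure (W.rate_pos e)
    rw [← hlaw 0] at this
    exact (integrable_map_measure (by fun_prop) (W.measurable_eval _).aemeasurable).1 this
  · intro m n hmn
    exact W.iIndepFun_eval.indepFun fun h => hmn (by simpa using h)
  · intro n
    exact ⟨(W.measurable_eval _).aemeasurable, (W.measurable_eval _).aemeasurable,
      by rw [hlaw, hlaw]⟩

theorem ae_regular [Finite W.Pair] : ∀ᵐ x ∂W.contactLaw, W.Regular x := by
  have hpos : ∀ᵐ x ∂W.contactLaw, ∀ p, 0 < x p := by
    rw [ae_all_iff]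
    intro p
    have h := expMeasure_ae_pos (W.rate p.1)
    rw [show expMeasure (W.rate p.1) = W.contactLaw.map (fun x => x p) from
      (W.map_eval_contactLaw p).symm] at h
    exact ae_of_ae_map (W.measurable_eval p).aemeasurable h
  have havg := ae_all_iff.2 W.ae_tendsto_average
  filter_upwards [hpos, havg] with x hx ha
  have hsum : ∀ e n, ∑ k ∈ Finset.Icc 1 n, x (e, k) = ∑ k ∈ Finset.range n, x (e, k + 1) := by
    intro e n
    rw [Finset.range_eq_Ico, Finset.sum_Ico_add' (fun k => x (e, k)) 0 n 1]
    rfl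
  refine ⟨hx, fun e => ?_, fun e => ?_⟩
  · have h1 : Tendsto (fun n : ℕ => ∑ k ∈ Finset.range n, x (e, k + 1)) atTop atTop := by
      have := (ha e).pos_mul_atTop (one_div_pos.2 (W.rate_pos e)) tendsto_natCast_atTop_atTop
      refine this.congr' ?_
      filter_upwards [eventually_ne_atTop 0] with n hn
      field_simp
    refine tendsto_atTop_mono (fun n => ?_) h1
    rw [arrival, Finset.sum_range_succ']
    linarith [hx (e, 0)]
  · have h1 := (ha e).inv₀ (one_div_pos.2 (W.rate_pos e)).ne'
    rw [one_div, inv_inv] at h1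
    refine h1.congr fun n => ?_
    rw [mle, hsum, inv_div]

/-! ### The equations of the expected latency -/

/-- The expectation of `wait`. -/
def meanWait (d : V) (B : DecisionMatrix V) (k : ℕ) (i : V) : ℝ≥0∞ :=
  ∫⁻ x, W.wait d B k i x ∂W.contactLaw

variable (d : V) (B : DecisionMatrix V)

theorem meanWait_self (k : ℕ) : W.meanWait d B k d = 0 := by
  have : ∀ x, W.wait d B k d x = 0 := fun x => if_neg fun h => h 0 (Nat.zero_le k) rfl
  simp [meanWait, this]

theorem expectedLatency_eq_tsum [Finite V] [Finite W.Pair] [Nonempty W.Pair] (i : V) :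
    W.expectedLatency d B i = ∑' k, W.meanWait d B k i := by
  unfold meanWait
  rw [expectedLatency, ← lintegral_tsum fun k => (W.measurable_wait d B k i).aemeasurable]
  refine lintegral_congr_ae ?_
  filter_upwards [W.ae_regular] with x hx using hx.latency_eq_tsum d B i

variable [Fintype W.Pair] [Nonempty W.Pair]

theorem meanWait_zero {i : V} (hi : i ≠ d) :
    W.meanWait d B 0 i = ENNReal.ofReal (1 / W.totalRate) := by
  simp only [meanWait, wait_zero, if_neg hi, lintegral_timeAfter_one]

variable [Finite V]

/-- Given the first meeting `e`, the remaining contacts have law `contactLaw` and the message starts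
from its new holder. -/
theorem meanWait_succ {i : V} (hi : i ≠ d) (k : ℕ) :
    W.meanWait d B (k + 1) i =
      ∑ e, ENNReal.ofReal (W.rate e / W.totalRate) *
        W.meanWait d B k (W.handOver B (some e) i) := by
  rw [meanWait, lintegral_eq_sum_pairAt]
  refine Finset.sum_congr rfl fun e _ => ?_
  rw [meanWait, ← W.setLIntegral_shift e (W.measurable_wait d B k _)]
  refine setLIntegral_congr_fun (W.measurableSet_pairAt 0 _) fun x hx => ?_
  rw [wait_succ W hx, if_neg hi]

/-- The latencies satisfy the equations given by the first meeting. -/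
theorem expectedLatency_eq {i : V} (hi : i ≠ d) :
    W.expectedLatency d B i = ENNReal.ofReal (1 / W.totalRate) +
      ∑ e, ENNReal.ofReal (W.rate e / W.totalRate) *
        W.expectedLatency d B (W.handOver B (some e) i) := by
  simp only [expectedLatency_eq_tsum]
  rw [tsum_eq_zero_add' ENNReal.summable, W.meanWait_zero d B hi]
  simp only [W.meanWait_succ d B hi]
  rw [Summable.tsum_finsetSum fun _ _ => ENNReal.summable]
  simp only [ENNReal.tsum_mul_left]

/-- Among the solutions of these equations, the latencies are the least one. -/
theorem expectedLatency_le {v : V → ℝ≥0∞}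
    (hv : ∀ i ≠ d, ENNReal.ofReal (1 / W.totalRate) +
      ∑ e, ENNReal.ofReal (W.rate e / W.totalRate) * v (W.handOver B (some e) i) ≤ v i) (i : V) :
    W.expectedLatency d B i ≤ v i := by
  -- The first `n + 1` waits are the initial one plus an average of the first `n` waits from the
  -- next holder, so `hv` carries the bound from `n` to `n + 1`.
  have h : ∀ n i, ∑ k ∈ Finset.range n, W.meanWait d B k i ≤ v i := by
    intro n
    induction n with
    | zero => simp
    | succ n ih =>
      intro i
      by_cases hi : i = d
      · subst hi; simp [meanWait_self]
      · rw [Finset.sum_range_succ', W.meanWait_zero d B hi, add_comm]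
        refine le_trans ?_ (hv i hi)
        simp only [W.meanWait_succ d B hi]
        rw [Finset.sum_comm]
        simp only [← Finset.mul_sum]
        gcongr with e _
        exact ih _
  rw [expectedLatency_eq_tsum]
  exact le_of_tendsto' (ENNReal.tendsto_nat_tsum _) fun n => h n i

end

section

variable {V : Type*} (W : ContactNetwork V)

theorem expectedLatency_self (d : V) (B : DecisionMatrix V) : W.expectedLatency d B d = 0 := by
  have : ∀ x, W.latency d x B d = 0 := fun x => by
    refine le_antisymm ((iInf₂_le 0 (show W.holder x B d 0 = d from rfl)).trans ?_) zero_le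
    simp [timeAfter]
  simp [expectedLatency, this]

end

end MinLat.ContactNetwork

namespace MinLat.ContactNetwork

noncomputable section

open scoped Classical

variable {V : Type*} (W : ContactNetwork V)

/-! ### The local optimization problem -/

/-- The meeting rate of two nodes, which is `0` if they are not neighbours. -/
def nodeRate (i j : V) : ℝ := if h : W.graph.Adj i j then W.rate ⟨s(i, j), h⟩ else 0

theorem nodeRate_pos {i j : V} (h : W.graph.Adj i j) : 0 < W.nodeRate i j := by
  rw [nodeRate, dif_pos h]; exact W.rate_pos _

/-- `nodeRate` as an extended nonnegative number. -/
def trueRate (i j : V) : ℝ≥0∞ := ENNReal.ofReal (W.nodeRate i j)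

theorem objective_empty (l L : V → ℝ≥0∞) : objective l L ∅ = ∞ := by
  simp [objective]

theorem minObjective_le {i : V} {l L : V → ℝ≥0∞} {S : Finset V} (hS : ∀ k ∈ S, W.graph.Adj i k) :
    W.minObjective i l L ≤ objective l L S := iInf₂_le S hS

theorem objective_mono {l L L' : V → ℝ≥0∞} {S : Finset V} (h : ∀ k ∈ S, L k ≤ L' k) :
    objective l L S ≤ objective l L' S := by
  unfold objective
  gcongr with k hk
  exact h k hk

theorem minObjective_mono {i : V} {l L L' : V → ℝ≥0∞} (h : ∀ k, W.graph.Adj i k → L k ≤ L' k) :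
    W.minObjective i l L ≤ W.minObjective i l L' :=
  iInf₂_mono fun _ hS => objective_mono fun k hk => h k (hS k hk)

theorem minObjective_congr {i : V} {l L L' : V → ℝ≥0∞} (h : ∀ k, W.graph.Adj i k → L k = L' k) :
    W.minObjective i l L = W.minObjective i l L' :=
  le_antisymm (W.minObjective_mono fun k hk => (h k hk).le)
    (W.minObjective_mono fun k hk => (h k hk).ge)

/-- The objective, for finite latencies, as a real number. -/
theorem objective_trueRate {i : V} {S : Finset V} (hS : ∀ k ∈ S, W.graph.Adj i k)
    (hne : S.Nonempty) {L : V → ℝ≥0∞} (hL : ∀ k, L k ≠ ∞) :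
    objective (W.trueRate i) L S = ENNReal.ofReal
      ((1 + ∑ k ∈ S, W.nodeRate i k * (L k).toReal) / ∑ k ∈ S, W.nodeRate i k) := by
  have hpos : 0 < ∑ k ∈ S, W.nodeRate i k :=
    Finset.sum_pos (fun k hk => W.nodeRate_pos (hS k hk)) hne
  have hn : ∀ k ∈ S, 0 ≤ W.nodeRate i k * (L k).toReal := fun k hk =>
    mul_nonneg (W.nodeRate_pos (hS k hk)).le ENNReal.toReal_nonneg
  rw [ENNReal.ofReal_div_of_pos hpos, ENNReal.ofReal_add zero_le_one (Finset.sum_nonneg hn),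
    ENNReal.ofReal_sum_of_nonneg hn,
    ENNReal.ofReal_sum_of_nonneg fun k hk => (W.nodeRate_pos (hS k hk)).le, ENNReal.ofReal_one,
    objective]
  congr 2
  refine Finset.sum_congr rfl fun k hk => ?_
  rw [ENNReal.ofReal_mul (W.nodeRate_pos (hS k hk)).le, ENNReal.ofReal_toReal (hL k), trueRate]

/-- Limits of latencies may be `∞`. Positive finite rates rule out `0 · ∞` and `∞ / ∞`; the summand
`1` in the numerator rules out `0 / 0`. -/
theorem tendsto_objective {ι : Type*} {F : Filter ι} {i : V} {S : Finset V}
    (hS : ∀ k ∈ S, W.graph.Adj i k) {l L : ι → V → ℝ≥0∞} {c : V → ℝ≥0∞}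
    (hl : ∀ k, W.graph.Adj i k → Tendsto (fun n => l n k) F (𝓝 (W.trueRate i k)))
    (hL : ∀ k, W.graph.Adj i k → Tendsto (fun n => L n k) F (𝓝 (c k))) :
    Tendsto (fun n => objective (l n) (L n) S) F (𝓝 (objective (W.trueRate i) c S)) := by
  have h0 : ∀ k ∈ S, W.trueRate i k ≠ 0 := fun k hk => by
    simpa [trueRate] using W.nodeRate_pos (hS k hk)
  rcases S.eq_empty_or_nonempty with rfl | ⟨j, hj⟩
  · simp only [objective_empty]; exact tendsto_const_nhds
  · have hden : ∑ k ∈ S, W.trueRate i k ≠ ∞ := ENNReal.sum_ne_top.2 fun _ _ => ENNReal.ofReal_ne_top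
    refine ENNReal.Tendsto.div (tendsto_const_nhds.add (tendsto_finsetSum S fun k hk =>
      ENNReal.Tendsto.mul (hl k (hS k hk)) (Or.inl (h0 k hk)) (hL k (hS k hk))
        (Or.inr ENNReal.ofReal_ne_top))) (Or.inl (by simp))
      (tendsto_finsetSum S fun k hk => hl k (hS k hk)) (Or.inl hden)

/-- Finiteness propagates backwards along a walk to `d`: waiting for the next node of the walk alone
already gives a finite objective. -/
theorem finite_of_le_minObjective {d : V} {U : V → ℝ≥0∞} (hd : U d = 0)
    (hU : ∀ i ≠ d, U i ≤ W.minObjective i (W.trueRate i) U) (i : V) : U i ≠ ∞ := by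
  obtain ⟨p⟩ := W.connected.preconnected i d
  induction p with
  | nil => simp [hd]
  | @cons i j d h p ih =>
    by_cases hi : i = d
    · subst hi; simp [hd]
    · have hj := ih hd hU
      have hS : ∀ k ∈ ({j} : Finset V), W.graph.Adj i k := by simpa using h
      refine ne_top_of_le_ne_top ?_ ((hU i hi).trans (W.minObjective_le hS))
      have h0 : W.trueRate i j ≠ 0 := by simpa [trueRate] using W.nodeRate_pos h
      simp only [objective, Finset.sum_singleton]
      exact ENNReal.div_ne_top (ENNReal.add_ne_top.2
        ⟨ENNReal.one_ne_top, ENNReal.mul_ne_top ENNReal.ofReal_ne_top hj⟩) h0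

section

variable [Finite V]

theorem exists_isMinimizer (i : V) (l L : V → ℝ≥0∞) : ∃ S, W.IsMinimizer i l L S := by
  have : Nonempty {S : Finset V // ∀ k ∈ S, W.graph.Adj i k} := ⟨∅, by simp⟩
  obtain ⟨⟨S, hS⟩, h⟩ := Finite.exists_min
    fun S : {S : Finset V // ∀ k ∈ S, W.graph.Adj i k} => objective l L S
  exact ⟨S, hS, le_antisymm (le_iInf₂ fun T hT => h ⟨T, hT⟩) (W.minObjective_le hS)⟩

theorem tendsto_minObjective {ι : Type*} {F : Filter ι} {i : V} {l L : ι → V → ℝ≥0∞}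
    {c : V → ℝ≥0∞}
    (hl : ∀ k, W.graph.Adj i k → Tendsto (fun n => l n k) F (𝓝 (W.trueRate i k)))
    (hL : ∀ k, W.graph.Adj i k → Tendsto (fun n => L n k) F (𝓝 (c k))) :
    Tendsto (fun n => W.minObjective i (l n) (L n)) F (𝓝 (W.minObjective i (W.trueRate i) c)) := by
  have : Fintype V := Fintype.ofFinite V
  have key : ∀ l L : V → ℝ≥0∞, W.minObjective i l L =
      (Finset.univ.filter fun S : Finset V => ∀ k ∈ S, W.graph.Adj i k).inf (objective l L) := by
    intro l L
    rw [Finset.inf_eq_iInf, minObjective]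
    simp
  simp only [key]
  exact Tendsto.finset_inf_nhds_apply fun S hS =>
    W.tendsto_objective (Finset.mem_filter.1 hS).2 hl hL

/-- If the data converge, minimizers are eventually minimizers of the limit problem. -/
theorem eventually_isMinimizer {ι : Type*} {F : Filter ι} {i : V} {l L : ι → V → ℝ≥0∞}
    {c : V → ℝ≥0∞}
    (hl : ∀ k, W.graph.Adj i k → Tendsto (fun n => l n k) F (𝓝 (W.trueRate i k)))
    (hL : ∀ k, W.graph.Adj i k → Tendsto (fun n => L n k) F (𝓝 (c k))) :
    ∀ᶠ n in F, ∀ S, W.IsMinimizer i (l n) (L n) S → W.IsMinimizer i (W.trueRate i) c S := by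
  refine eventually_all.2 fun S => ?_
  by_cases hS : ∀ k ∈ S, W.graph.Adj i k
  · by_cases h : objective (W.trueRate i) c S = W.minObjective i (W.trueRate i) c
    · exact Eventually.of_forall fun _ _ => ⟨hS, h⟩
    · have hlt := lt_of_le_of_ne (W.minObjective_le hS) (Ne.symm h)
      filter_upwards [(W.tendsto_minObjective hl hL).eventually_lt (W.tendsto_objective hS hl hL) hlt]
        with n hn hmin
      exact absurd hmin.2 hn.ne'
  · exact Eventually.of_forall fun _ h => absurd h.1 hS

/-! ### The optimality equations -/

/-- Comparison principle for the optimality equations. -/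
theorem le_of_le_minObjective {d : V} {U L : V → ℝ≥0∞} (hd : U d = 0)
    (hU : ∀ i ≠ d, U i ≤ W.minObjective i (W.trueRate i) U)
    (hL : ∀ i ≠ d, W.minObjective i (W.trueRate i) L ≤ L i) (hLfin : ∀ i, L i ≠ ∞) (i : V) :
    U i ≤ L i := by
  have : Fintype V := Fintype.ofFinite V
  have hUfin := W.finite_of_le_minObjective hd hU
  -- Both inequalities, multiplied by the total rate of `S`, are taken at the same set: a minimizer
  -- for `L`, which is merely admissible for `U`.
  have key : ∀ i ≠ d, ∃ S : Finset V, (∀ k ∈ S, 0 < W.nodeRate i k) ∧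
      1 ≤ ∑ k ∈ S, W.nodeRate i k * ((L i).toReal - (L k).toReal) ∧
      ∑ k ∈ S, W.nodeRate i k * ((U i).toReal - (U k).toReal) ≤ 1 := by
    intro i hi
    obtain ⟨S, hS, hSmin⟩ := W.exists_isMinimizer i (W.trueRate i) L
    have h1 := hSmin.trans_le (hL i hi)
    have hne : S.Nonempty := by
      rw [Finset.nonempty_iff_ne_empty]
      rintro rfl
      rw [objective_empty] at h1
      exact hLfin i (top_le_iff.1 h1)
    have h2 := (hU i hi).trans (W.minObjective_le hS)
    have hpos : 0 < ∑ k ∈ S, W.nodeRate i k :=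
      Finset.sum_pos (fun k hk => W.nodeRate_pos (hS k hk)) hne
    have hnn : ∀ G : V → ℝ≥0∞, 0 ≤ ∑ k ∈ S, W.nodeRate i k * (G k).toReal := fun G =>
      Finset.sum_nonneg fun k hk => mul_nonneg (W.nodeRate_pos (hS k hk)).le ENNReal.toReal_nonneg
    rw [W.objective_trueRate hS hne hLfin, ← ENNReal.ofReal_toReal (hLfin i),
      ENNReal.ofReal_le_ofReal_iff ENNReal.toReal_nonneg, div_le_iff₀ hpos, Finset.mul_sum] at h1
    rw [W.objective_trueRate hS hne hUfin, ← ENNReal.ofReal_toReal (hUfin i),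
      ENNReal.ofReal_le_ofReal_iff (div_nonneg (by linarith [hnn U]) hpos.le), le_div_iff₀ hpos,
      Finset.mul_sum] at h2
    refine ⟨S, fun k hk => W.nodeRate_pos (hS k hk), ?_, ?_⟩ <;>
      simp only [mul_sub, Finset.sum_sub_distrib, mul_comm (W.nodeRate i _) (ENNReal.toReal _)] at * <;>
      linarith
  rw [← ENNReal.toReal_le_toReal (hUfin i) (hLfin i)]
  by_contra! hlt
  have hne : (Finset.univ : Finset V).Nonempty := ⟨i, Finset.mem_univ i⟩
  obtain ⟨m, -, hm⟩ := Finset.exists_max_image Finset.univ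
    (fun i => (U i).toReal - (L i).toReal) hne
  have hne' : (Finset.univ.filter fun i =>
      (U i).toReal - (L i).toReal = (U m).toReal - (L m).toReal).Nonempty := ⟨m, by simp⟩
  -- Among the nodes where `U - L` is maximal, one with least `L` is taken; without this choice the
  -- maximum principle yields only equality.
  obtain ⟨a, ha, hamin⟩ := Finset.exists_min_image _ (fun i => (L i).toReal) hne'
  rw [Finset.mem_filter] at ha
  have hmi := hm i (Finset.mem_univ i)
  have had : a ≠ d := by
    rintro rfl
    have h1 : (L a).toReal ≥ 0 := ENNReal.toReal_nonneg
    have h2 := ha.2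
    rw [hd, ENNReal.toReal_zero] at h2
    linarith
  obtain ⟨S, hr, h1, h2⟩ := key a had
  have hterm : ∀ k ∈ S, 0 ≤ W.nodeRate a k * (((U a).toReal - (L a).toReal) -
      ((U k).toReal - (L k).toReal)) := fun k hk =>
    mul_nonneg (hr k hk).le (by linarith [hm k (Finset.mem_univ k), ha.2])
  have hsum : ∑ k ∈ S, W.nodeRate a k * (((U a).toReal - (L a).toReal) -
      ((U k).toReal - (L k).toReal)) = 0 := by
    refine le_antisymm ?_ (Finset.sum_nonneg hterm)
    have : ∑ k ∈ S, W.nodeRate a k * (((U a).toReal - (L a).toReal) -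
        ((U k).toReal - (L k).toReal)) =
        ∑ k ∈ S, W.nodeRate a k * ((U a).toReal - (U k).toReal) -
        ∑ k ∈ S, W.nodeRate a k * ((L a).toReal - (L k).toReal) := by
      rw [← Finset.sum_sub_distrib]
      exact Finset.sum_congr rfl fun k _ => by ring
    linarith
  have hzero := (Finset.sum_eq_zero_iff_of_nonneg hterm).1 hsum
  -- By `hzero` all of `S` maximizes `U - L` too, so `L a ≤ L k` there, contradicting `h1`.
  have hle : ∑ k ∈ S, W.nodeRate a k * ((L a).toReal - (L k).toReal) ≤ 0 := by
    refine Finset.sum_nonpos fun k hk => ?_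
    have hk0 := (mul_eq_zero.1 (hzero k hk)).resolve_left (hr k hk).ne'
    have := hamin k (Finset.mem_filter.2 ⟨Finset.mem_univ k, by linarith [ha.2]⟩)
    exact mul_nonpos_of_nonneg_of_nonpos (hr k hk).le (by linarith)
  linarith

end

end

end MinLat.ContactNetwork

namespace MinLat.ContactNetwork

noncomputable section

open scoped Classical

variable {V : Type*} (W : ContactNetwork V)

/-! ### Latencies and the optimality equations -/

theorem handOver_edge (B : DecisionMatrix V) {i j : V} (h : W.graph.Adj i j) :
    W.handOver B (some ⟨s(i, j), h⟩) i = if j ∈ B i then j else i := by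
  have hm : i ∈ s(i, j) := Sym2.mem_mk_left i j
  have ho : Sym2.Mem.other hm = j := Sym2.congr_right.1 (Sym2.other_spec hm)
  simp only [handOver, dif_pos hm, ho]

/-- Only pairs joining `i` to a neighbour in row `i` move the message. The filter is needed because
an arbitrary matrix may list non-neighbours. -/
theorem sum_rate_mul_handOver [Fintype W.Pair] (B : DecisionMatrix V) (i : V) (g : V → ℝ) :
    ∑ e, W.rate e * (g (W.handOver B (some e) i) - g i) =
      ∑ j ∈ (B i).filter (W.graph.Adj i), W.nodeRate i j * (g j - g i) := by
  rw [← Finset.sum_attach ((B i).filter (W.graph.Adj i))]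
  symm
  refine Finset.sum_of_injOn (g := fun e => W.rate e * (g (W.handOver B (some e) i) - g i))
    (fun j : {j // j ∈ (B i).filter (W.graph.Adj i)} =>
      (⟨s(i, j), (Finset.mem_filter.1 j.2).2⟩ : W.Pair)) ?_ (fun _ _ => Finset.mem_univ _) ?_ ?_
  · intro j _ k _ h
    exact Subtype.ext (Sym2.congr_right.1 (congrArg Subtype.val h))
  · rintro ⟨e, he⟩ - hne
    by_cases hi : i ∈ e
    · obtain ⟨j, rfl⟩ := Sym2.mem_iff_exists.1 hi
      have hj : j ∉ B i := fun hj =>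
        hne ⟨⟨j, Finset.mem_filter.2 ⟨hj, he⟩⟩, Finset.mem_coe.2 (Finset.mem_attach _ _), rfl⟩
      have := W.handOver_edge B (show W.graph.Adj i j from he)
      rw [this, if_neg hj, sub_self, mul_zero]
    · simp [handOver, hi]
  · rintro ⟨j, hj⟩ -
    obtain ⟨h1, h2⟩ := Finset.mem_filter.1 hj
    rw [W.handOver_edge B h2, if_pos h1, nodeRate, dif_pos h2]

/-- The weights `rate e / totalRate` sum to `1`, so the average over the first meeting is `v i` plus
weighted differences. Comparison with `v i` becomes a sign condition involving only row `i`. -/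
theorem first_step_eq [Fintype W.Pair] [Nonempty W.Pair] (B : DecisionMatrix V) (i : V)
    {v : V → ℝ≥0∞} (hv : ∀ i, v i ≠ ∞) :
    ENNReal.ofReal (1 / W.totalRate) +
      ∑ e, ENNReal.ofReal (W.rate e / W.totalRate) * v (W.handOver B (some e) i) =
    ENNReal.ofReal ((v i).toReal + (1 + ∑ j ∈ (B i).filter (W.graph.Adj i),
      W.nodeRate i j * ((v j).toReal - (v i).toReal)) / W.totalRate) := by
  have hT := W.totalRate_pos
  have h0 : ∀ e, 0 ≤ W.rate e / W.totalRate := fun e => (div_pos (W.rate_pos e) hT).le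
  have h1 : ∀ e, ENNReal.ofReal (W.rate e / W.totalRate) * v (W.handOver B (some e) i) =
      ENNReal.ofReal (W.rate e / W.totalRate * (v (W.handOver B (some e) i)).toReal) := fun e => by
    rw [ENNReal.ofReal_mul (h0 e), ENNReal.ofReal_toReal (hv _)]
  have h2 : ∀ e ∈ Finset.univ,
      0 ≤ W.rate e / W.totalRate * (v (W.handOver B (some e) i)).toReal := fun e _ =>
    mul_nonneg (h0 e) ENNReal.toReal_nonneg
  rw [Finset.sum_congr rfl fun e _ => h1 e, ← ENNReal.ofReal_sum_of_nonneg h2,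
    ← ENNReal.ofReal_add (by positivity) (Finset.sum_nonneg h2),
    ← W.sum_rate_mul_handOver B i fun j => (v j).toReal]
  congr 1
  simp only [mul_sub, Finset.sum_sub_distrib, ← Finset.sum_mul, div_mul_eq_mul_div,
    ← Finset.sum_div]
  change _ = _ + (1 + (_ - W.totalRate * _)) / _
  field_simp
  ring

section

variable [Finite V] [Nonempty W.Pair] (d : V)

/-- Clearing the denominator, the hypothesis says that `v` is a supersolution of the first-step
equations, and the latencies are their least solution. -/
theorem expectedLatency_le_of_objective_le {B : DecisionMatrix V}
    (hB : ∀ i ≠ d, ∀ k ∈ B i, W.graph.Adj i k) {v : V → ℝ≥0∞} (hv : ∀ i, v i ≠ ∞)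
    (h : ∀ i ≠ d, objective (W.trueRate i) v (B i) ≤ v i) (i : V) :
    W.expectedLatency d B i ≤ v i := by
  have : Fintype W.Pair := Fintype.ofFinite _
  refine W.expectedLatency_le d B (fun i hi => ?_) i
  have hS := hB i hi
  have hle := h i hi
  have hne : (B i).Nonempty := by
    rw [Finset.nonempty_iff_ne_empty]
    intro h0
    rw [h0, objective_empty] at hle
    exact hv i (top_le_iff.1 hle)
  have hpos : 0 < ∑ k ∈ B i, W.nodeRate i k :=
    Finset.sum_pos (fun k hk => W.nodeRate_pos (hS k hk)) hne
  rw [W.objective_trueRate hS hne hv, ← ENNReal.ofReal_toReal (hv i),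
    ENNReal.ofReal_le_ofReal_iff ENNReal.toReal_nonneg, div_le_iff₀ hpos, Finset.mul_sum] at hle
  rw [W.first_step_eq B i hv, Finset.filter_true_of_mem hS, ← ENNReal.ofReal_toReal (hv i),
    ENNReal.toReal_ofReal ENNReal.toReal_nonneg]
  refine ENNReal.ofReal_le_ofReal (add_le_of_nonpos_right ?_)
  refine div_nonpos_of_nonpos_of_nonneg ?_ W.totalRate_pos.le
  simp only [mul_sub, Finset.sum_sub_distrib, mul_comm (W.nodeRate i _) (v i).toReal]
  linarith

theorem minObjective_le_expectedLatency {B : DecisionMatrix V}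
    (hfin : ∀ i, W.expectedLatency d B i ≠ ∞) {i : V} (hi : i ≠ d) :
    W.minObjective i (W.trueRate i) (W.expectedLatency d B) ≤ W.expectedLatency d B i := by
  have : Fintype W.Pair := Fintype.ofFinite _
  have h := W.expectedLatency_eq d B hi
  set u := W.expectedLatency d B
  set S := (B i).filter (W.graph.Adj i)
  have hS : ∀ k ∈ S, W.graph.Adj i k := fun k hk => (Finset.mem_filter.1 hk).2
  rw [W.first_step_eq B i hfin] at h
  -- A positive value would make the right side of `h` strictly larger than the finite `u i`.
  have hsum : 1 + ∑ j ∈ S, W.nodeRate i j * ((u j).toReal - (u i).toReal) ≤ 0 := by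
    by_contra! hlt
    have h1 := div_pos hlt W.totalRate_pos
    have h2 := congrArg ENNReal.toReal h
    rw [ENNReal.toReal_ofReal (add_nonneg ENNReal.toReal_nonneg h1.le)] at h2
    linarith
  have hne : S.Nonempty := by
    rw [Finset.nonempty_iff_ne_empty]
    intro h0
    rw [h0, Finset.sum_empty] at hsum
    linarith
  have hpos : 0 < ∑ k ∈ S, W.nodeRate i k :=
    Finset.sum_pos (fun k hk => W.nodeRate_pos (hS k hk)) hne
  refine (W.minObjective_le hS).trans ?_
  rw [W.objective_trueRate hS hne hfin, ← ENNReal.ofReal_toReal (hfin i)]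
  refine ENNReal.ofReal_le_ofReal ?_
  rw [div_le_iff₀ hpos, Finset.mul_sum]
  simp only [mul_sub, Finset.sum_sub_distrib, mul_comm (W.nodeRate i _) (u i).toReal] at hsum
  linarith

/-- A solution of the optimality equations gives the latencies of the matrices whose rows are
minimizers. -/
theorem expectedLatency_eq_of_isMinimizer {d : V} {v : V → ℝ≥0∞} (hd : v d = 0)
    (hv : ∀ i ≠ d, v i = W.minObjective i (W.trueRate i) v) {B : DecisionMatrix V}
    (hB : ∀ i ≠ d, W.IsMinimizer i (W.trueRate i) v (B i)) (i : V) :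
    W.expectedLatency d B i = v i := by
  have hfin := W.finite_of_le_minObjective hd fun i hi => (hv i hi).le
  have hle := W.expectedLatency_le_of_objective_le d (fun i hi => (hB i hi).1) hfin
    fun i hi => (hB i hi).2.trans_le (hv i hi).ge
  have hfin' := fun i => ne_top_of_le_ne_top (hfin i) (hle i)
  exact le_antisymm (hle i) (W.le_of_le_minObjective hd (fun i hi => (hv i hi).le)
    (fun i hi => W.minObjective_le_expectedLatency d hfin' hi) hfin' i)

end

/-- A solution of the optimality equations gives the optimal latencies. -/
theorem expectedLatency_eq_of_isOptimal [Fintype V] [Nonempty W.Pair] {d : V} {v : V → ℝ≥0∞}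
    (hd : v d = 0) (hv : ∀ i ≠ d, v i = W.minObjective i (W.trueRate i) v)
    {B : DecisionMatrix V} (hB : W.IsOptimal d B) (i : V) : W.expectedLatency d B i = v i := by
  have hfin := W.finite_of_le_minObjective hd fun i hi => (hv i hi).le
  choose B₀ hB₀ using fun i => W.exists_isMinimizer i (W.trueRate i) v
  have h₀ := W.expectedLatency_eq_of_isMinimizer hd hv (B := B₀) fun i _ => hB₀ i
  have hsum : ∑ i, W.expectedLatency d B i ≤ ∑ i, v i :=
    (hB B₀).trans_eq (Finset.sum_congr rfl fun i _ => h₀ i)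
  have hvs : ∑ i, v i ≠ ∞ := ENNReal.sum_ne_top.2 fun i _ => hfin i
  have hfin' : ∀ i, W.expectedLatency d B i ≠ ∞ := fun i =>
    ENNReal.sum_ne_top.1 (ne_top_of_le_ne_top hvs hsum) i (Finset.mem_univ i)
  -- Optimality bounds only the sum; as `v` is also a lower bound entry by entry, every entry must
  -- agree.
  have hle := W.le_of_le_minObjective hd (fun i hi => (hv i hi).le)
    (fun i hi => W.minObjective_le_expectedLatency d hfin' hi) hfin'
  refine le_antisymm ?_ (hle i)
  rw [← Finset.add_sum_erase _ _ (Finset.mem_univ i),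
    ← Finset.add_sum_erase _ v (Finset.mem_univ i)] at hsum
  have hvs' : ∑ j ∈ Finset.univ.erase i, v j ≠ ∞ := ENNReal.sum_ne_top.2 fun i _ => hfin i
  rw [← ENNReal.add_le_add_iff_right hvs']
  exact (add_le_add le_rfl (Finset.sum_le_sum fun j _ => hle j)).trans hsum

end

end MinLat.ContactNetwork

namespace MinLat.ContactNetwork

noncomputable section

open scoped Classical

variable {V : Type*} {W : ContactNetwork V}

/-! ### The algorithm on a regular realization -/

/-- `ev` marks the updates of a quantity that is otherwise constant: one late update establishes
`Q`, and neither later updates nor pauses destroy it. -/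
theorem _root_.MinLat.eventually_of_update {ev Q : ℕ → Prop} (hinf : ∀ K, ∃ k ≥ K, ev k)
    (h1 : ∀ᶠ k in atTop, ev k → Q (k + 1)) (h2 : ∀ k, ¬ ev k → Q k → Q (k + 1)) :
    ∀ᶠ k in atTop, Q k := by
  obtain ⟨K, hK⟩ := eventually_atTop.1 h1
  obtain ⟨m, hm, hev⟩ := hinf K
  refine eventually_atTop.2 ⟨m + 1, fun k hk => ?_⟩
  induction k, hk using Nat.le_induction with
  | base => exact hK m hm hev
  | succ k hk ih =>
    by_cases h : ev k
    · exact hK k (by omega) h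
    · exact h2 k h ih

section

variable (d : V) (r₀ : W.Pair → ℝ≥0) (x : W.Path)

theorem latencyTable_succ {k : ℕ} {e : W.Pair} (h : W.pairAt x k = some e) :
    W.latencyTable d r₀ x (k + 1) =
      W.updateTable d (W.rateEstimate r₀ x (k + 1)) e (W.latencyTable d r₀ x k) := by
  rw [latencyTable, h]

theorem latencyTable_succ_none {k : ℕ} (h : W.pairAt x k = none) :
    W.latencyTable d r₀ x (k + 1) = W.latencyTable d r₀ x k := by
  rw [latencyTable, h]

theorem latencyTable_dest (k : ℕ) (a : V) : W.latencyTable d r₀ x k a d = 0 := by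
  induction k generalizing a with
  | zero => simp [latencyTable]
  | succ k ih =>
    rcases h : W.pairAt x k with _ | e
    · rw [latencyTable_succ_none _ _ _ h, ih]
    · rw [latencyTable_succ _ _ _ h, updateTable, if_neg (by rintro ⟨h1, -, h2⟩; exact h2 h1.symm),
        exchange]
      split_ifs <;> exact ih _

/-- The entry for a neighbour is a delayed copy of that neighbour's own estimate, taken before the
neighbour minimizes in the same meeting. -/
theorem latencyTable_neighbour {k : ℕ} {a b : V} (hab : W.graph.Adj a b) :
    W.latencyTable d r₀ x (k + 1) a b =
      if W.pairAt x k = some ⟨s(a, b), hab⟩ then W.latencyTable d r₀ x k b b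
      else W.latencyTable d r₀ x k a b := by
  rcases h : W.pairAt x k with _ | e
  · rw [latencyTable_succ_none _ _ _ h, if_neg (by simp)]
  · rw [latencyTable_succ _ _ _ h, updateTable, if_neg (fun h => hab.ne h.1.symm), exchange]
    congr 1
    rw [Option.some.injEq, Subtype.ext_iff]
    exact propext eq_comm

theorem latencyTable_of_meets {k : ℕ} {a : V} (h : W.Meets x k a ∧ a ≠ d) :
    W.latencyTable d r₀ x (k + 1) a a =
      W.minObjective a (W.rateEstimate r₀ x (k + 1) a) (W.latencyTable d r₀ x (k + 1) a) := by
  obtain ⟨⟨e, he, hae⟩, had⟩ := h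
  rw [latencyTable_succ _ _ _ he, updateTable, if_pos ⟨rfl, hae, had⟩]
  -- Minimization alters only diagonal entries, and the objective of `a` reads only neighbours, so
  -- the table after the whole update may be used.
  refine W.minObjective_congr fun k hk => ?_
  rw [updateTable, if_neg (fun h => hk.ne h.1.symm)]

theorem latencyTable_of_not_meets {k : ℕ} {a : V} (h : ¬ (W.Meets x k a ∧ a ≠ d)) :
    W.latencyTable d r₀ x (k + 1) a a = W.latencyTable d r₀ x k a a := by
  rcases he : W.pairAt x k with _ | e
  · rw [latencyTable_succ_none _ _ _ he]
  · rw [latencyTable_succ _ _ _ he, updateTable,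
      if_neg (fun h' => h ⟨⟨e, he, h'.2.1⟩, h'.2.2⟩), exchange, ite_self]

end

variable [Finite W.Pair] [Nonempty W.Pair] {x : W.Path}

theorem Regular.meets_infinitely_of_ne (hx : W.Regular x) {a d : V} (h : a ≠ d) (K : ℕ) :
    ∃ k ≥ K, W.Meets x k a := by
  have : Nontrivial V := ⟨a, d, h⟩
  obtain ⟨b, hb⟩ := W.connected.preconnected.exists_adj_of_nontrivial a
  obtain ⟨k, hk, hk'⟩ := hx.meets_infinitely ⟨s(a, b), hb⟩ K
  exact ⟨k, hk, _, hk', Sym2.mem_mk_left a b⟩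

theorem Regular.eventually_neighbour (hx : W.Regular x) {d : V} {r₀ : W.Pair → ℝ≥0}
    {p : ℝ≥0∞ → Prop} {a b : V} (hab : W.graph.Adj a b)
    (h : ∀ᶠ k in atTop, p (W.latencyTable d r₀ x k b b)) :
    ∀ᶠ k in atTop, p (W.latencyTable d r₀ x k a b) := by
  refine eventually_of_update (hx.meets_infinitely ⟨s(a, b), hab⟩) ?_ ?_
  · filter_upwards [h] with k hk hev
    rwa [latencyTable_neighbour d r₀ x hab, if_pos hev]
  · intro k hev hk
    rwa [latencyTable_neighbour d r₀ x hab, if_neg hev]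

theorem Regular.eventually_self (hx : W.Regular x) {d : V} {r₀ : W.Pair → ℝ≥0}
    {p : ℝ≥0∞ → Prop} {a : V} (had : a ≠ d)
    (h : ∀ᶠ k in atTop,
      p (W.minObjective a (W.rateEstimate r₀ x k a) (W.latencyTable d r₀ x k a))) :
    ∀ᶠ k in atTop, p (W.latencyTable d r₀ x k a a) := by
  refine eventually_of_update (ev := fun k => W.Meets x k a ∧ a ≠ d)
    (fun K => (hx.meets_infinitely_of_ne had K).imp fun k hk => ⟨hk.1, hk.2, had⟩) ?_ ?_
  · filter_upwards [(tendsto_add_atTop_nat 1).eventually h] with k hk hev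
    rwa [latencyTable_of_meets d r₀ x hev]
  · intro k hev hk
    rwa [latencyTable_of_not_meets d r₀ x hev]

theorem Regular.tendsto_rateEstimate (hx : W.Regular x) (r₀ : W.Pair → ℝ≥0) {a b : V}
    (hab : W.graph.Adj a b) :
    Tendsto (fun k => W.rateEstimate r₀ x k a b) atTop (𝓝 (W.trueRate a b)) := by
  have hc := hx.counts_tendsto ⟨s(a, b), hab⟩
  have h1 := (ENNReal.tendsto_ofReal (hx.mle_tendsto ⟨s(a, b), hab⟩)).comp
    ((tendsto_sub_atTop_nat 1).comp hc)
  rw [trueRate, nodeRate, dif_pos hab]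
  refine h1.congr' ?_
  filter_upwards [hc.eventually_gt_atTop 1] with k hk
  rw [rateEstimate, dif_pos hab, pairEstimate, if_neg (not_le.2 hk)]
  rfl

theorem Regular.limsup_neighbour_le (hx : W.Regular x) (d : V) (r₀ : W.Pair → ℝ≥0) {a b : V}
    (hab : W.graph.Adj a b) :
    limsup (fun k => W.latencyTable d r₀ x k a b) atTop ≤
      limsup (fun k => W.latencyTable d r₀ x k b b) atTop := by
  refine le_of_forall_gt_imp_ge_of_dense fun c hc => ?_
  exact limsup_le_of_le (by isBoundedDefault)
    ((hx.eventually_neighbour hab (p := (· < c)) (eventually_lt_of_limsup_lt hc)).mono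
      fun _ h => h.le)

theorem Regular.le_liminf_neighbour (hx : W.Regular x) (d : V) (r₀ : W.Pair → ℝ≥0) {a b : V}
    (hab : W.graph.Adj a b) :
    liminf (fun k => W.latencyTable d r₀ x k b b) atTop ≤
      liminf (fun k => W.latencyTable d r₀ x k a b) atTop := by
  refine le_of_forall_lt_imp_le_of_dense fun c hc => ?_
  exact le_liminf_of_le (by isBoundedDefault)
    ((hx.eventually_neighbour hab (p := (c < ·)) (eventually_lt_of_lt_liminf hc)).mono
      fun _ h => h.le)

variable [Finite V]

/-- The current entries lie below their tail suprema, which decrease to the limsup. Monotonicity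
bounds each update by the objective at these suprema, and continuity passes to the limit. -/
theorem Regular.limsup_le_minObjective (hx : W.Regular x) {d : V} (r₀ : W.Pair → ℝ≥0) {a : V}
    (had : a ≠ d) :
    limsup (fun k => W.latencyTable d r₀ x k a a) atTop ≤
      W.minObjective a (W.trueRate a)
        fun b => limsup (fun k => W.latencyTable d r₀ x k b b) atTop := by
  refine le_of_forall_gt_imp_ge_of_dense fun c hc => ?_
  have hlim : ∀ b, Tendsto (fun k => ⨆ m ≥ k, W.latencyTable d r₀ x m a b) atTop
      (𝓝 (limsup (fun k => W.latencyTable d r₀ x k a b) atTop)) := fun b => by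
    rw [limsup_eq_iInf_iSup_of_nat]
    exact tendsto_atTop_iInf fun m n hmn => biSup_mono fun _ h => le_trans hmn h
  have h1 := W.tendsto_minObjective (fun b hb => hx.tendsto_rateEstimate r₀ hb)
    (fun b (_ : W.graph.Adj a b) => hlim b)
  have h3 : W.minObjective a (W.trueRate a)
      (fun b => limsup (fun k => W.latencyTable d r₀ x k a b) atTop) < c :=
    lt_of_le_of_lt (W.minObjective_mono fun b hb => hx.limsup_neighbour_le d r₀ hb) hc
  have h2 := h1.eventually_lt_const h3
  refine limsup_le_of_le (by isBoundedDefault)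
    ((hx.eventually_self had (p := (· < c)) ?_).mono fun _ h => h.le)
  filter_upwards [h2] with k hk
  refine lt_of_le_of_lt (W.minObjective_mono fun b _ => ?_) hk
  exact le_iSup₂ (f := fun m (_ : m ≥ k) => W.latencyTable d r₀ x m a b) k le_rfl

theorem Regular.minObjective_le_liminf (hx : W.Regular x) {d : V} (r₀ : W.Pair → ℝ≥0) {a : V}
    (had : a ≠ d) :
    W.minObjective a (W.trueRate a)
        (fun b => liminf (fun k => W.latencyTable d r₀ x k b b) atTop) ≤
      liminf (fun k => W.latencyTable d r₀ x k a a) atTop := by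
  refine le_of_forall_lt_imp_le_of_dense fun c hc => ?_
  have hlim : ∀ b, Tendsto (fun k => ⨅ m ≥ k, W.latencyTable d r₀ x m a b) atTop
      (𝓝 (liminf (fun k => W.latencyTable d r₀ x k a b) atTop)) := fun b => by
    rw [liminf_eq_iSup_iInf_of_nat]
    exact tendsto_atTop_iSup fun m n hmn => biInf_mono fun _ h => le_trans hmn h
  have h1 := W.tendsto_minObjective (fun b hb => hx.tendsto_rateEstimate r₀ hb)
    (fun b (_ : W.graph.Adj a b) => hlim b)
  have h2 := h1.eventually_const_lt (hc.trans_le (W.minObjective_mono fun b hb =>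
    hx.le_liminf_neighbour d r₀ hb))
  refine le_liminf_of_le (by isBoundedDefault)
    ((hx.eventually_self had (p := (c < ·)) ?_).mono fun _ h => h.le)
  filter_upwards [h2] with k hk
  exact hk.trans_le (W.minObjective_mono fun b _ => iInf₂_le_of_le k le_rfl le_rfl)

/-- On a regular realization the estimates converge to a solution of the optimality equations. -/
theorem Regular.exists_limit (hx : W.Regular x) (d : V) (r₀ : W.Pair → ℝ≥0) :
    ∃ v : V → ℝ≥0∞, v d = 0 ∧ (∀ i ≠ d, v i = W.minObjective i (W.trueRate i) v) ∧
      ∀ i, Tendsto (fun k => W.latencyTable d r₀ x k i i) atTop (𝓝 (v i)) := by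
  set U : V → ℝ≥0∞ := fun i => limsup (fun k => W.latencyTable d r₀ x k i i) atTop with hU
  set L : V → ℝ≥0∞ := fun i => liminf (fun k => W.latencyTable d r₀ x k i i) atTop with hL
  have hUd : U d = 0 := by simp [hU, latencyTable_dest]
  have hU1 : ∀ i ≠ d, U i ≤ W.minObjective i (W.trueRate i) U :=
    fun i hi => hx.limsup_le_minObjective r₀ hi
  have hL1 : ∀ i ≠ d, W.minObjective i (W.trueRate i) L ≤ L i :=
    fun i hi => hx.minObjective_le_liminf r₀ hi
  have hLU : ∀ i, L i ≤ U i := fun i => liminf_le_limsup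
  -- The initial estimates are `∞`; that they become bounded comes from the subsolution inequality
  -- and connectedness.
  have hfin := W.finite_of_le_minObjective hUd hU1
  have hUL := W.le_of_le_minObjective hUd hU1 hL1 fun i => ne_top_of_le_ne_top (hfin i) (hLU i)
  have heq : L = U := funext fun i => le_antisymm (hLU i) (hUL i)
  refine ⟨U, hUd, fun i hi => le_antisymm (hU1 i hi) ?_, fun i =>
    tendsto_of_le_liminf_of_limsup_le (hUL i) le_rfl⟩
  have := hL1 i hi
  rwa [heq] at this

theorem Regular.eventually_isMinimizer (hx : W.Regular x) {d : V} {r₀ : W.Pair → ℝ≥0}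
    {v : V → ℝ≥0∞} (hv : ∀ i, Tendsto (fun k => W.latencyTable d r₀ x k i i) atTop (𝓝 (v i)))
    (a : V) :
    ∀ᶠ k in atTop, ∀ S,
      W.IsMinimizer a (W.rateEstimate r₀ x k a) (W.latencyTable d r₀ x k a) S →
        W.IsMinimizer a (W.trueRate a) v S :=
  W.eventually_isMinimizer (fun _ hb => hx.tendsto_rateEstimate r₀ hb) fun b hb =>
    tendsto_def.2 fun s hs => hx.eventually_neighbour hb (p := (· ∈ s)) ((hv b).eventually hs)

end

end MinLat.ContactNetwork

namespace MinLat

theorem tendsto_measure_compl_of_eventually_mem {α : Type*} [MeasurableSpace α] (P : Measure α)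
    [IsProbabilityMeasure P] {Q : ℕ → Set α} (hQ : ∀ n, MeasurableSet (Q n)) (hmono : Monotone Q)
    (h : ∀ᵐ x ∂P, ∃ n, x ∈ Q n) : Tendsto (fun n => P (Q n)ᶜ) atTop (𝓝 0) := by
  have h0 : P (⋂ n, (Q n)ᶜ) = 0 := by
    rw [← Set.compl_iUnion]
    exact measure_mono_null (fun x hx => by simpa using hx) h
  rw [← h0]
  exact tendsto_measure_iInter_atTop (fun n => (hQ n).compl.nullMeasurableSet)
    (fun _ _ hmn => Set.compl_subset_compl.2 (hmono hmn)) ⟨0, measure_ne_top _ _⟩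

theorem convergesInProbability_of_eq {Ω : Type*} [MeasurableSpace Ω] (μ : Measure Ω)
    {Y : ℝ → Ω → ℝ≥0∞} {c : ℝ≥0∞} (hc : c ≠ ∞) (h : ∀ t ω, Y t ω = c) :
    ConvergesInProbability μ Y c := by
  refine ⟨hc, fun ε hε => ?_⟩
  have : ∀ t, {ω | ¬ (Y t ω ≠ ∞ ∧ |(Y t ω).toReal - c.toReal| < ε)} = ∅ := fun t => by
    ext ω
    simp [h t ω, hc, hε]
  simp only [this, measure_empty]
  exact tendsto_const_nhds

namespace ContactNetwork

noncomputable section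

open scoped Classical

variable {V : Type*} (W : ContactNetwork V)

/-! ### Convergence in probability -/

/-- After `k` meetings the estimate at `i` is within `ε` of `v i`, and the minimizers of the local
problems of all nodes are minimizers for the true rates and the latencies `v`. -/
def accurate (d : V) (r₀ : W.Pair → ℝ≥0) (v : V → ℝ≥0∞) (i : V) (ε : ℝ) (k : ℕ) : Set W.Path :=
  {x | (∀ a S, W.IsMinimizer a (W.rateEstimate r₀ x k a) (W.latencyTable d r₀ x k a) S →
      W.IsMinimizer a (W.trueRate a) v S) ∧
    W.latencyTable d r₀ x k i i ≠ ∞ ∧ |(W.latencyTable d r₀ x k i i).toReal - (v i).toReal| < ε}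

/-- The realizations that are accurate from some meeting on, after which every node updates its row
before time `n`. -/
def settled (d : V) (r₀ : W.Pair → ℝ≥0) (v : V → ℝ≥0∞) (i : V) (ε : ℝ) (n : ℕ) : Set W.Path :=
  {x | ∃ K, ∃ M ≥ K, (∀ k ≥ K, x ∈ W.accurate d r₀ v i ε k) ∧
    (∀ a ≠ d, ∃ k < M, K ≤ k ∧ W.Meets x k a) ∧ ∀ k < M, W.timeAfter x (k + 1) ≤ n}

theorem settled_mono (d : V) (r₀ : W.Pair → ℝ≥0) (v : V → ℝ≥0∞) (i : V) (ε : ℝ) :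
    Monotone (W.settled d r₀ v i ε) := by
  rintro m n hmn x ⟨K, M, hKM, h1, h2, h3⟩
  exact ⟨K, M, hKM, h1, h2, fun k hk => (h3 k hk).trans (by exact_mod_cast hmn)⟩

section

variable [Finite V]

theorem measurableSet_accurate (d : V) (r₀ : W.Pair → ℝ≥0) (v : V → ℝ≥0∞) (i : V) (ε : ℝ) (k : ℕ) :
    MeasurableSet (W.accurate d r₀ v i ε k) := by
  have hL := W.measurable_latencyTable d r₀ k i i
  have h1 : MeasurableSet {x | ∀ a S,
      W.IsMinimizer a (W.rateEstimate r₀ x k a) (W.latencyTable d r₀ x k a) S →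
        W.IsMinimizer a (W.trueRate a) v S} := by
    simp only [Set.ofPred_forall]
    exact MeasurableSet.iInter fun a => MeasurableSet.iInter fun S =>
      (W.measurableSet_isMinimizer d r₀ k a S).imp (MeasurableSet.const _)
  have h2 : MeasurableSet {x | W.latencyTable d r₀ x k i i ≠ ∞} :=
    (measurableSet_eq_fun hL measurable_const).compl
  have h3 : MeasurableSet
      {x | |(W.latencyTable d r₀ x k i i).toReal - (v i).toReal| < ε} :=
    measurableSet_lt (by fun_prop) measurable_const
  exact h1.inter (h2.inter h3)

theorem measurableSet_settled (d : V) (r₀ : W.Pair → ℝ≥0) (v : V → ℝ≥0∞) (i : V) (ε : ℝ) (n : ℕ) :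
    MeasurableSet (W.settled d r₀ v i ε n) := by
  simp only [settled, Set.ofPred_exists, Set.ofPred_and, Set.ofPred_forall]
  refine MeasurableSet.iUnion fun K => MeasurableSet.iUnion fun M =>
    (MeasurableSet.const _).inter (MeasurableSet.inter ?_ (MeasurableSet.inter ?_ ?_))
  · exact MeasurableSet.iInter fun k => MeasurableSet.iInter fun _ =>
      W.measurableSet_accurate d r₀ v i ε k
  · exact MeasurableSet.iInter fun a => MeasurableSet.iInter fun _ => MeasurableSet.iUnion fun k =>
      (MeasurableSet.const _).inter ((MeasurableSet.const _).inter (W.measurableSet_meets k a))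
  · exact MeasurableSet.iInter fun k => MeasurableSet.iInter fun _ =>
      measurableSet_le (W.measurable_timeAfter _) measurable_const

variable {W}
variable [Nonempty W.Pair] {x : W.Path} {d : V} {r₀ : W.Pair → ℝ≥0} {v : V → ℝ≥0∞}

theorem Regular.exists_settled (hx : W.Regular x)
    (hv : ∀ i, Tendsto (fun k => W.latencyTable d r₀ x k i i) atTop (𝓝 (v i))) (i : V)
    (hvi : v i ≠ ∞) {ε : ℝ} (hε : 0 < ε) : ∃ n, x ∈ W.settled d r₀ v i ε n := by
  have h1 : ∀ᶠ k in atTop, x ∈ W.accurate d r₀ v i ε k := by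
    have ha := eventually_all.2 fun a => hx.eventually_isMinimizer hv a
    have hb := (hv i).eventually_ne hvi
    have hc := ((ENNReal.tendsto_toReal hvi).comp (hv i)).eventually (Metric.ball_mem_nhds _ hε)
    filter_upwards [ha, hb, hc] with k h1 h2 h3
    exact ⟨h1, h2, by simpa [Real.dist_eq] using h3⟩
  obtain ⟨K, hK⟩ := eventually_atTop.1 h1
  have h2 : ∀ a, ∃ k, a ≠ d → K ≤ k ∧ W.Meets x k a := fun a => by
    by_cases ha : a = d
    · exact ⟨0, fun h => absurd ha h⟩
    · obtain ⟨k, hk⟩ := hx.meets_infinitely_of_ne ha K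
      exact ⟨k, fun _ => hk⟩
  choose m hm using h2
  obtain ⟨N, hN⟩ := (Set.finite_range m).bddAbove
  obtain ⟨n, hn⟩ := exists_nat_ge (W.timeAfter x (N + K + 1))
  -- `N` bounds the chosen update indices, so by meeting `N + K + 1` every node has updated since
  -- `K`; `n` is a time by which these meetings are over.
  refine ⟨n, K, N + K + 1, by omega, hK, fun a ha => ⟨m a, ?_, hm a ha⟩, fun k hk => ?_⟩
  · have := hN (Set.mem_range_self a)
    omega
  · exact (hx.timeAfter_mono (by omega)).trans hn

/-- By time `t` each row has been recomputed from accurate data, and a row changes afterwards only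
by another such recomputation. -/
theorem Regular.of_mem_settled (hx : W.Regular x) {i : V} {ε : ℝ} {n : ℕ} {t : ℝ} (ht : n ≤ t)
    (hxn : x ∈ W.settled d r₀ v i ε n) {D : ℕ → DecisionMatrix V}
    (hD : W.IsDecisionSequence d r₀ x D) :
    (W.estimatedLatency d r₀ x t i ≠ ∞ ∧
      |(W.estimatedLatency d r₀ x t i).toReal - (v i).toReal| < ε) ∧
    ∀ a ≠ d, W.IsMinimizer a (W.trueRate a) v (D (W.meetingsUntil x t) a) := by
  obtain ⟨K, M, hKM, h1, h2, h3⟩ := hxn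
  have hM := hx.le_meetingsUntil (t := t) fun k hk => (h3 k hk).trans ht
  refine ⟨(h1 _ (hKM.trans hM)).2, fun a ha => ?_⟩
  obtain ⟨k, hkM, hKk, hmeet⟩ := h2 a ha
  have key : ∀ m ≥ k + 1, W.IsMinimizer a (W.trueRate a) v (D m a) := by
    intro m hm
    induction m, hm using Nat.le_induction with
    | base => exact (h1 (k + 1) (by omega)).1 a _ ((hD.2 k a).1 ⟨hmeet, ha⟩)
    | succ m hm ih =>
      by_cases h : W.Meets x m a ∧ a ≠ d
      · exact (h1 (m + 1) (by omega)).1 a _ ((hD.2 m a).1 h)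
      · rw [(hD.2 m a).2 h]; exact ih
  exact key _ (by omega)

end

end

end ContactNetwork

end MinLat

/-! ### Convergence in probability on an arbitrary probability space. -/

theorem theorem4 {V : Type*} [Fintype V] (W : MinLat.ContactNetwork V) (d : V)
    {Ω : Type*} [MeasurableSpace Ω] (μ : Measure Ω) [IsProbabilityMeasure μ]
    (X : W.Pair × ℕ → Ω → ℝ)
    (hX : ∀ p, HasLaw (X p) (expMeasure (W.rate p.1)) μ)
    (hindep : iIndepFun X μ)
    (r₀ : W.Pair → ℝ≥0)
    (D : Ω → ℕ → MinLat.DecisionMatrix V)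
    (hD : ∀ ω, W.IsDecisionSequence d r₀ (fun p => X p ω) (D ω))
    (Bopt : MinLat.DecisionMatrix V) (hopt : W.IsOptimal d Bopt) (i : V) :
    MinLat.ConvergesInProbability μ
        (fun t ω => W.estimatedLatency d r₀ (fun p => X p ω) t i)
        (W.expectedLatency d Bopt i) ∧
      MinLat.ConvergesInProbability μ
        (fun t ω =>
          W.expectedLatency d (D ω (W.meetingsUntil (fun p => X p ω) t)) i)
        (W.expectedLatency d Bopt i) := by
  by_cases hid : i = d
  · subst hid
    rw [W.expectedLatency_self]
    exact ⟨MinLat.convergesInProbability_of_eq μ ENNReal.zero_ne_top fun t ω =>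
        MinLat.ContactNetwork.latencyTable_dest _ _ _ _ _,
      MinLat.convergesInProbability_of_eq μ ENNReal.zero_ne_top fun t ω =>
        W.expectedLatency_self _ _⟩
  -- The case `i = d` is separate because a one-node network has no pairs at all.
  have : Nontrivial V := ⟨i, d, hid⟩
  have : Nonempty W.Pair := by
    obtain ⟨b, hb⟩ := W.connected.preconnected.exists_adj_of_nontrivial i
    exact ⟨⟨s(i, b), hb⟩⟩
  have hξ : HasLaw (fun ω p => X p ω) W.contactLaw μ :=
    hindep.hasLaw_infinitePi hX (aemeasurable_pi_lambda _ fun p => (hX p).aemeasurable)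
  set v := W.expectedLatency d Bopt with hvdef
  have hreg : ∀ᵐ ω ∂μ, W.Regular fun p => X p ω :=
    ae_of_ae_map hξ.aemeasurable (hξ.map_eq.symm ▸ W.ae_regular)
  have hlim : ∀ x, W.Regular x → v d = 0 ∧
      (∀ j ≠ d, v j = W.minObjective j (W.trueRate j) v) ∧
      ∀ j, Tendsto (fun k => W.latencyTable d r₀ x k j j) atTop (𝓝 (v j)) := by
    intro x hx
    obtain ⟨u, hu⟩ := hx.exists_limit d r₀
    have : v = u := funext fun j => W.expectedLatency_eq_of_isOptimal hu.1 hu.2.1 hopt j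
    rwa [this]
  -- The equations for `v` do not involve the realization, so a single regular one provides them,
  -- and with them the finiteness of the optimal latencies.
  obtain ⟨x₀, hx₀⟩ := W.ae_regular.exists
  obtain ⟨hvd, hveq, -⟩ := hlim x₀ hx₀
  have hvfin := W.finite_of_le_minObjective hvd fun j hj => (hveq j hj).le
  have hzero : ∀ ε > 0, Tendsto (fun t : ℝ =>
      W.contactLaw (W.settled d r₀ v i ε ⌊t⌋₊)ᶜ) atTop (𝓝 0) := fun ε hε =>
    (MinLat.tendsto_measure_compl_of_eventually_mem W.contactLaw
      (W.measurableSet_settled d r₀ v i ε) (W.settled_mono d r₀ v i ε)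
      (W.ae_regular.mono fun x hx => hx.exists_settled (hlim x hx).2.2 i (hvfin i) hε)).comp
      tendsto_nat_floor_atTop
  -- Minimizers are chosen arbitrarily for each `ω`, so `Y` need not be measurable; its failure set
  -- is covered, up to a null set, by the preimage of the complement of `settled`.
  have hbad : ∀ (Y : ℝ → Ω → ℝ≥0∞) (ε : ℝ), 0 < ε →
      (∀ t ≥ 0, ∀ ω, W.Regular (fun p => X p ω) →
        (fun p => X p ω) ∈ W.settled d r₀ v i ε ⌊t⌋₊ →
        Y t ω ≠ ∞ ∧ |(Y t ω).toReal - (v i).toReal| < ε) →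
      Tendsto (fun t => μ {ω | ¬ (Y t ω ≠ ∞ ∧ |(Y t ω).toReal - (v i).toReal| < ε)})
        atTop (𝓝 0) := by
    intro Y ε hε hY
    refine tendsto_of_tendsto_of_tendsto_of_le_of_le' tendsto_const_nhds (hzero ε hε)
      (Eventually.of_forall fun _ => zero_le) ?_
    filter_upwards [eventually_ge_atTop 0] with t ht
    rw [← hξ.map_eq, Measure.map_apply_of_aemeasurable hξ.aemeasurable
      (W.measurableSet_settled d r₀ v i ε _).compl]
    refine measure_mono_ae ?_
    filter_upwards [hreg] with ω hω hbad hmem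
    exact hbad (hY t ht ω hω hmem)
  refine ⟨⟨hvfin i, fun ε hε => hbad _ ε hε fun t ht ω hω hmem =>
    (hω.of_mem_settled (Nat.floor_le ht) hmem (hD ω)).1⟩, ⟨hvfin i, fun ε hε =>
    hbad _ ε hε fun t ht ω hω hmem => ?_⟩⟩
  have hrow := (hω.of_mem_settled (Nat.floor_le ht) hmem (hD ω)).2
  -- On a settled realization the achieved latency equals the optimum exactly.
  rw [W.expectedLatency_eq_of_isMinimizer hvd hveq hrow i]
  exact ⟨hvfin i, by simpa using hε⟩
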